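/- Let $1\le k<n$, let $A\in\mathbb{R}^{k\times n}$ have full row rank, let $b\in\mathbb{R}^k$, and let $f:\mathbb{R}^n\to\mathbb{R}$ be convex and twice differentiable. Consider the problem $$\min_{x\in\mathbb{R}^n} f(x)\quad\text{subject to}\quad Ax=b \qquad (1)$$ and the associated primal-dual dynamics $$\dot x=-\nabla f(x)-A^\top\nu,\qquad \dot\nu=Ax-b, \qquad (2)$$ written $\dot z=F(z)$ with $z=(x,\nu)\in\mathbb{R}^{n+k}$. Then: 1. System (2) is weakly contractive with respect to $\|\cdot\|_2$: it has a unique trajectory on $[t_0,\infty)$ from every initial condition at every time $t_0\ge 0$, and any two trajectories satisfy $\|z(t)-w(t)\|_2\le\|z(t_0)-w(t_0)\|_2$ for all $t\ge t_0\ge 0$. Moreover, if $(x^*,\nu^*)$ is an equilibrium of (2) with $\nabla^2 f(x^*)\succ 0$, then $(x^*,\nu^*)$ is globally asymptotically stable. 2. Suppose in addition that, for constants $\ell_{\inf},\ell_{\sup}>0$ and all $x,y\in\mathbb{R}^n$, $f$ satisfies $\ell_{\inf}\|x-y\|_2^2\le(\nabla f(x)-\nabla f(y))^\top(x-y)$ (strong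 convexity) and $\|\nabla f(x)-\nabla f(y)\|_2\le\ell_{\sup}\|x-y\|_2$ (Lipschitz smoothness). Let $\sigma_{\max}$ and $\sigma_{\min}$ be the largest and the smallest singular values of $A$ (the smallest among its $k$ singular values). (a) For every $0<\epsilon<1$ put $$\alpha_\epsilon=\frac{\epsilon\,\ell_{\inf}}{\sigma_{\max}^2+\frac34\sigma_{\max}\sigma_{\min}^2+\ell_{\sup}^2},\qquad P=\begin{bmatrix}I_n&\alpha_\epsilon A^\top\\ \alpha_\epsilon A&I_k\end{bmatrix},\qquad c=\alpha_\epsilon\,\frac34\,\frac{\sigma_{\max}\sigma_{\min}^2}{\sigma_{\max}+1}.$$ Then $\alpha_\epsilon>0$, $c>0$, $P$ is positive definite, and (2) is contractive with contraction rate $c$ with respect to the norm $\|z\|_{2,P^{1/2}}=\|P^{1/2}z\|_2$: any two trajectories satisfy $\|z(t)-w(t)\|_{2,P^{1/2}}\le\|z(t_0)-w(t_0)\|_{2,P^{1/2}}\,e^{-c(t-t_0)}$ for all $t\ge t_0\ge 0$, and $\mu_{2,P^{1/2}}(DF(z))\le -c$ for all $z$, where $\mu_{2,P^{1/2}}(M)=\lim_{h\to0^+}(\|I+hM\|_{2,P^{1/2}}-1)/h$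 is the matrix measure defined by the induced norm. (b) System (2) has a unique equilibrium $(x^*,\nu^*)$; it is globally exponentially stable, and $x^*$ is the unique solution of problem (1). -/

import Mathlib

namespace PrimalDual

open Set Filter Topology

open scoped MatrixOrder

noncomputable section

/-! ### Time-invariant dynamical systems `ż = F z` on `[t₀, ∞)` -/

section Dynamics

variable {E : Type*} [NormedAddCommGroup E] [NormedSpace ℝ E]

/-- `z` solves `ż = F z` on the set of times `s`
(with one-sided derivatives at the endpoints of an interval). -/
def IsSolutionOn (F : E → E) (s : Set ℝ) (z : ℝ → E) : Prop :=
  ∀ t ∈ s, HasDerivWithinAt z (F (z t)) s t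

/-- `z` is a trajectory of `ż = F z` starting at time `t₀`. -/
def IsTrajectory (F : E → E) (t₀ : ℝ) (z : ℝ → E) : Prop :=
  IsSolutionOn F (Ici t₀) z

/-- The flow `φ(t, t₀, z₀)` is well defined for all `t ≥ t₀ ≥ 0` and all `z₀`: there is a
trajectory from every initial condition, and solutions on an interval `[t₀, T]` are determined
by their initial value. -/
def HasFlow (F : E → E) : Prop :=
  (∀ t₀ : ℝ, 0 ≤ t₀ → ∀ z₀ : E, ∃ z : ℝ → E, IsTrajectory F t₀ z ∧ z t₀ = z₀) ∧
  (∀ t₀ : ℝ, 0 ≤ t₀ → ∀ T : ℝ, ∀ z w : ℝ → E,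
    IsSolutionOn F (Icc t₀ T) z → IsSolutionOn F (Icc t₀ T) w → z t₀ = w t₀ →
      EqOn z w (Icc t₀ T))

/-- The flow satisfies `N (φ(t,t₀,z₀) - φ(t,t₀,w₀)) ≤ N (z₀ - w₀) e^{-c (t - t₀)}`;
here `N` is a norm on `E`. -/
def FlowContracts (N : E → ℝ) (c : ℝ) (F : E → E) : Prop :=
  HasFlow F ∧
  ∀ t₀ : ℝ, 0 ≤ t₀ → ∀ z w : ℝ → E, IsTrajectory F t₀ z → IsTrajectory F t₀ w →
    ∀ t : ℝ, t₀ ≤ t → N (z t - w t) ≤ N (z t₀ - w t₀) * Real.exp (-c * (t - t₀))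

/-- Weak contractivity with respect to the norm `N`. -/
def WeaklyContractive (N : E → ℝ) (F : E → E) : Prop :=
  FlowContracts N 0 F

/-- The operator norm induced by a norm `N` on `E`. -/
def inducedNorm (N : E → ℝ) (M : E →L[ℝ] E) : ℝ :=
  sInf {C : ℝ | 0 ≤ C ∧ ∀ v : E, N (M v) ≤ C * N v}

/-- The matrix measure of `M` associated to `N`, i.e. the limit of `(‖I + hM‖ - 1) / h` as
`h → 0⁺` for the induced norm, exists and equals `m`. -/
def HasMatrixMeasure (N : E → ℝ) (M : E →L[ℝ] E) (m : ℝ) : Prop :=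
  Tendsto (fun h : ℝ => (inducedNorm N (ContinuousLinearMap.id ℝ E + h • M) - 1) / h)
    (𝓝[>] 0) (𝓝 m)

/-- The system `ż = F z` is contractive with respect to the norm `N` with contraction rate `c`:
`c > 0`, trajectories approach each other at the exponential rate `c`, and the matrix measure of
the Jacobian is everywhere at most `-c`. -/
def ContractiveWithRate (N : E → ℝ) (c : ℝ) (F : E → E) : Prop :=
  0 < c ∧ FlowContracts N c F ∧ Differentiable ℝ F ∧
    ∀ z : E, ∃ m : ℝ, HasMatrixMeasure N (fderiv ℝ F z) m ∧ m ≤ -c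

/-- `z` is an equilibrium of `ż = F z`. -/
def IsEquilibrium (F : E → E) (z : E) : Prop := F z = 0

/-- Global asymptotic stability: Lyapunov stability and global attractivity. -/
def GloballyAsymptoticallyStable (F : E → E) (zs : E) : Prop :=
  (∀ ε : ℝ, 0 < ε → ∃ δ : ℝ, 0 < δ ∧ ∀ t₀ : ℝ, 0 ≤ t₀ → ∀ z : ℝ → E, IsTrajectory F t₀ z →
    ‖z t₀ - zs‖ < δ → ∀ t : ℝ, t₀ ≤ t → ‖z t - zs‖ < ε) ∧
  (∀ t₀ : ℝ, 0 ≤ t₀ → ∀ z : ℝ → E, IsTrajectory F t₀ z → Tendsto z atTop (𝓝 zs))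

/-- Global exponential stability. -/
def GloballyExponentiallyStable (F : E → E) (zs : E) : Prop :=
  ∃ K r : ℝ, 0 < K ∧ 0 < r ∧ ∀ t₀ : ℝ, 0 ≤ t₀ → ∀ z : ℝ → E, IsTrajectory F t₀ z →
    ∀ t : ℝ, t₀ ≤ t → ‖z t - zs‖ ≤ K * ‖z t₀ - zs‖ * Real.exp (-r * (t - t₀))

end Dynamics

/-! ### Objective functions -/

section Objective

variable {n : ℕ}

/-- `f` is twice (Fréchet) differentiable on all of `ℝⁿ`. -/
def TwiceDifferentiable (f : EuclideanSpace ℝ (Fin n) → ℝ) : Prop :=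
  Differentiable ℝ f ∧ Differentiable ℝ (gradient f)

/-- The Hessian `∇²f(x)` as the derivative of the gradient. -/
def hessian (f : EuclideanSpace ℝ (Fin n) → ℝ) (x : EuclideanSpace ℝ (Fin n)) :
    EuclideanSpace ℝ (Fin n) →L[ℝ] EuclideanSpace ℝ (Fin n) :=
  fderiv ℝ (gradient f) x

/-- `∇²f(x) ≻ 0`. -/
def HessianPosDef (f : EuclideanSpace ℝ (Fin n) → ℝ) (x : EuclideanSpace ℝ (Fin n)) : Prop :=
  ∀ v : EuclideanSpace ℝ (Fin n), v ≠ 0 → 0 < inner ℝ v (hessian f x v)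

/-- Lipschitz smoothness with constant `L` (of a differentiable function). -/
def LipschitzSmooth (f : EuclideanSpace ℝ (Fin n) → ℝ) (L : ℝ) : Prop :=
  ∀ x y : EuclideanSpace ℝ (Fin n), ‖gradient f x - gradient f y‖ ≤ L * ‖x - y‖

/-- Strong convexity with constant `l` (of a differentiable function). -/
def GradStronglyConvex (f : EuclideanSpace ℝ (Fin n) → ℝ) (l : ℝ) : Prop :=
  ∀ x y : EuclideanSpace ℝ (Fin n),
    l * ‖x - y‖ ^ 2 ≤ inner ℝ (gradient f x - gradient f y) (x - y)

/-- `x` solves the problem `min f(y)` subject to `A y = b`. -/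
def IsSolutionOfProgram {k : ℕ} (f : EuclideanSpace ℝ (Fin n) → ℝ) (A : Matrix (Fin k) (Fin n) ℝ)
    (b : EuclideanSpace ℝ (Fin k)) (x : EuclideanSpace ℝ (Fin n)) : Prop :=
  A.toEuclideanLin x = b ∧
    ∀ y : EuclideanSpace ℝ (Fin n), A.toEuclideanLin y = b → f x ≤ f y

end Objective

/-! ### Primal-dual dynamics -/

section PD

variable {n k : ℕ}

/-- The state space of pairs `(x, ν) ∈ ℝⁿ × ℝᵏ = ℝⁿ⁺ᵏ` with its Euclidean norm. -/
abbrev State (n k : ℕ) : Type := EuclideanSpace ℝ (Fin n ⊕ Fin k)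

/-- The primal part `x` of `(x, ν)`. -/
def primal (z : State n k) : EuclideanSpace ℝ (Fin n) :=
  WithLp.toLp 2 fun i => z (Sum.inl i)

/-- The dual part `ν` of `(x, ν)`. -/
def dual (z : State n k) : EuclideanSpace ℝ (Fin k) :=
  WithLp.toLp 2 fun j => z (Sum.inr j)

/-- The pair `(x, ν)`. -/
def pair (x : EuclideanSpace ℝ (Fin n)) (v : EuclideanSpace ℝ (Fin k)) : State n k :=
  WithLp.toLp 2 (Sum.elim (fun i => x i) (fun j => v j))

/-- The primal-dual vector field `(x, ν) ↦ (-∇f(x) - Aᵀν, A x - b)`. -/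
def pdField (f : EuclideanSpace ℝ (Fin n) → ℝ) (A : Matrix (Fin k) (Fin n) ℝ)
    (b : EuclideanSpace ℝ (Fin k)) (z : State n k) : State n k :=
  pair (-gradient f (primal z) - A.transpose.toEuclideanLin (dual z))
    (A.toEuclideanLin (primal z) - b)

/-- Largest singular value of `A`. -/
def sigmaMax (A : Matrix (Fin k) (Fin n) ℝ) : ℝ :=
  A.toEuclideanLin.singularValues 0

/-- Smallest of the `min k n` singular values of `A ∈ ℝᵏˣⁿ`
(Mathlib lists the singular values in decreasing order, from index `0`). -/
def sigmaMin (A : Matrix (Fin k) (Fin n) ℝ) : ℝ :=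
  A.toEuclideanLin.singularValues (min k n - 1)

/-- The constant `α_ε`. -/
def alphaEps (A : Matrix (Fin k) (Fin n) ℝ) (linf lsup ε : ℝ) : ℝ :=
  ε * linf / (sigmaMax A ^ 2 + 3 / 4 * sigmaMax A * sigmaMin A ^ 2 + lsup ^ 2)

/-- The matrix `P = [I, α Aᵀ; α A, I]`. -/
def weightP (A : Matrix (Fin k) (Fin n) ℝ) (α : ℝ) :
    Matrix (Fin n ⊕ Fin k) (Fin n ⊕ Fin k) ℝ :=
  Matrix.fromBlocks 1 (α • A.transpose) (α • A) 1

/-- The weighted norm `‖z‖_{2,Q} = ‖Q z‖₂`. -/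
def weightedNorm (Q : Matrix (Fin n ⊕ Fin k) (Fin n ⊕ Fin k) ℝ) (z : State n k) : ℝ :=
  ‖Q.toEuclideanLin z‖

/-- The positive semidefinite square root `P^{1/2}` (meaningful for positive semidefinite `P`). -/
def sqrtMatrix (P : Matrix (Fin n ⊕ Fin k) (Fin n ⊕ Fin k) ℝ) :
    Matrix (Fin n ⊕ Fin k) (Fin n ⊕ Fin k) ℝ :=
  CFC.sqrt P

/-- The contraction rate `α_ε · (3/4) · σ_max σ_min² / (σ_max + 1)`. -/
def pdRate (A : Matrix (Fin k) (Fin n) ℝ) (linf lsup ε : ℝ) : ℝ :=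
  alphaEps A linf lsup ε * (3 / 4) * (sigmaMax A * sigmaMin A ^ 2 / (sigmaMax A + 1))

end PD

end

end PrimalDual

/-! The coupling terms `-Aᵀν` and `Ax` form a skew map, so they cancel in `⟪z - w, F z - F w⟫`; what
remains is `-⟪∇f x - ∇f y, x - y⟫ ≤ 0` by convexity (`inner_pdField_sub`). Distances between
solutions therefore never grow, which also gives uniqueness. Existence is less direct, since `∇f` is
differentiable but need not be locally Lipschitz: the field is cut off and approximated by smooth
bounded fields, and dissipativity makes their solutions a Cauchy sequence
(`exists_isSolutionOn_of_monotone`).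

Asymptotic stability is LaSalle's principle. On a limiting trajectory the distance to the
equilibrium is constant, so the dissipation vanishes; a positive definite Hessian then pins the
primal part, and injectivity of `Aᵀ` pins the dual part.

In the Euclidean norm the dual direction is not damped. The off-diagonal blocks of `P` bring in a
term `-α‖Aᵀν‖²`, at a price absorbed by strong convexity when `α` is small (`saddle_dissipation`).
This one inequality, applied to increments of `F` and to its Jacobian, yields both the decay of
trajectories and the bound on the matrix measure. Contraction then forces a unique, exponentially
stable equilibrium, which is a KKT point and hence a minimizer. -/

namespace PrimalDual

open Set Filter Topology

open scoped MatrixOrder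

noncomputable section

/-! ### Dissipative fields: contraction and uniqueness of solutions. -/

section Contraction

variable {E : Type*} [NormedAddCommGroup E] [InnerProductSpace ℝ E]

open scoped RealInnerProductSpace

/-- Linear form of Grönwall's inequality on a closed interval. -/
theorem le_mul_exp_of_hasDerivWithinAt {W W' : ℝ → ℝ} {a b c : ℝ} (hab : a ≤ b)
    (hW : ∀ t ∈ Icc a b, HasDerivWithinAt W (W' t) (Icc a b) t)
    (hc : ∀ t ∈ Icc a b, W' t ≤ c * W t) :
    W b ≤ W a * Real.exp (c * (b - a)) := by
  have hd : ∀ t ∈ Icc a b, HasDerivWithinAt (fun t => W t * Real.exp (-c * (t - a)))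
      (W' t * Real.exp (-c * (t - a)) + W t * (Real.exp (-c * (t - a)) * (-c * 1)))
      (Icc a b) t := fun t ht =>
    (hW t ht).mul ((((hasDerivAt_id t).sub_const a).const_mul (-c)).exp).hasDerivWithinAt
  have hanti : AntitoneOn (fun t => W t * Real.exp (-c * (t - a))) (Icc a b) := by
    refine antitoneOn_of_hasDerivWithinAt_nonpos (convex_Icc a b)
      (fun t ht => (hd t ht).continuousWithinAt)
      (fun t ht => (hd t (interior_subset ht)).mono interior_subset) fun t ht => ?_
    have h1 := hc t (interior_subset ht)
    have h2 := Real.exp_pos (-c * (t - a))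
    nlinarith
  have h := hanti (left_mem_Icc.2 hab) (right_mem_Icc.2 hab) hab
  simp only [sub_self, mul_zero, Real.exp_zero, mul_one] at h
  have h2 : W b = W b * Real.exp (-c * (b - a)) * Real.exp (c * (b - a)) := by
    rw [mul_assoc, ← Real.exp_add]; simp
  rw [h2]
  exact mul_le_mul_of_nonneg_right h (Real.exp_pos _).le

theorem IsSolutionOn.mono {F : E → E} {s t : Set ℝ} {z : ℝ → E} (h : IsSolutionOn F t z)
    (hst : s ⊆ t) : IsSolutionOn F s z :=
  fun u hu => (h u (hst hu)).mono hst

theorem IsTrajectory.isSolutionOn_Icc {F : E → E} {a b : ℝ} {z : ℝ → E} (h : IsTrajectory F a z) :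
    IsSolutionOn F (Icc a b) z :=
  IsSolutionOn.mono h Icc_subset_Ici_self

theorem hasDerivWithinAt_norm_sq_clm {z : ℝ → E} {z' : E} {s : Set ℝ} {t : ℝ}
    (Q : E →L[ℝ] E) (h : HasDerivWithinAt z z' s t) :
    HasDerivWithinAt (fun t => ‖Q (z t)‖ ^ 2) (2 * ⟪Q (z t), Q z'⟫) s t :=
  (Q.hasFDerivAt.comp_hasDerivWithinAt t h).norm_sq

/-- Solutions of a field that is strongly dissipative for the inner product `⟪Q ·, Q ·⟫`
approach each other exponentially. -/
theorem norm_sub_le_of_dissipative {F : E → E} {Q : E →L[ℝ] E} {c : ℝ}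
    (hF : ∀ z w, ⟪Q (z - w), Q (F z - F w)⟫ ≤ -c * ‖Q (z - w)‖ ^ 2) {a b : ℝ} (hab : a ≤ b)
    {z w : ℝ → E} (hz : IsSolutionOn F (Icc a b) z) (hw : IsSolutionOn F (Icc a b) w) :
    ‖Q (z b - w b)‖ ≤ ‖Q (z a - w a)‖ * Real.exp (-c * (b - a)) := by
  have h := le_mul_exp_of_hasDerivWithinAt (c := -2 * c) hab
    (fun t ht => hasDerivWithinAt_norm_sq_clm Q ((hz t ht).fun_sub (hw t ht)))
    fun t _ => by linarith [hF (z t) (w t)]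
  refine le_of_sq_le_sq (h.trans_eq ?_) (by positivity)
  rw [mul_pow, ← Real.exp_nat_mul]
  congr 2
  push_cast
  ring

theorem norm_sub_le_of_monotone {F : E → E} (hF : ∀ z w, ⟪z - w, F z - F w⟫ ≤ 0) {a b : ℝ}
    (hab : a ≤ b) {z w : ℝ → E} (hz : IsSolutionOn F (Icc a b) z)
    (hw : IsSolutionOn F (Icc a b) w) : ‖z b - w b‖ ≤ ‖z a - w a‖ := by
  simpa using norm_sub_le_of_dissipative (Q := .id ℝ E) (c := 0) (by simpa using hF) hab hz hw

theorem eqOn_of_monotone {F : E → E} (hF : ∀ z w, ⟪z - w, F z - F w⟫ ≤ 0) {a b : ℝ}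
    {z w : ℝ → E} (hz : IsSolutionOn F (Icc a b) z) (hw : IsSolutionOn F (Icc a b) w)
    (h : z a = w a) : EqOn z w (Icc a b) := by
  intro t ht
  have hsub : Icc a t ⊆ Icc a b := Icc_subset_Icc_right ht.2
  have := norm_sub_le_of_monotone hF ht.1 (hz.mono hsub) (hw.mono hsub)
  rw [h, sub_self, norm_zero] at this
  exact sub_eq_zero.1 (norm_le_zero_iff.1 this)

end Contraction

/-! ### Existence of solutions for continuous dissipative fields. -/

section Existence

variable {E : Type*} [NormedAddCommGroup E] [InnerProductSpace ℝ E] [FiniteDimensional ℝ E]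

open scoped RealInnerProductSpace

/-- A bounded smooth field has solutions on every compact interval. -/
theorem exists_isSolutionOn_of_contDiff_of_bounded {g : E → E} (hg : ContDiff ℝ 1 g) {M : ℝ}
    (hM : ∀ z, ‖g z‖ ≤ M) {a b : ℝ} (hab : a ≤ b) (z₀ : E) :
    ∃ z : ℝ → E, z a = z₀ ∧ IsSolutionOn g (Icc a b) z := by
  have : CompleteSpace E := FiniteDimensional.complete ℝ E
  have : ProperSpace E := FiniteDimensional.proper ℝ E
  have hM0 : 0 ≤ M := (norm_nonneg _).trans (hM 0)
  have hr : 0 ≤ M * (b - a) := mul_nonneg hM0 (sub_nonneg.2 hab)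
  obtain ⟨C, hC⟩ := (isCompact_closedBall z₀ (M * (b - a))).exists_bound_of_continuousOn
    (hg.continuous_fderiv one_ne_zero).continuousOn
  have hP : IsPicardLindelof (fun _ => g) (tmin := a) (tmax := b) ⟨a, left_mem_Icc.2 hab⟩ z₀
      ⟨M * (b - a), hr⟩ 0 ⟨M, hM0⟩ C.toNNReal := by
    refine ⟨fun t _ => ?_, fun _ _ => continuousOn_const, fun _ _ x _ => hM x, ?_⟩
    · refine (convex_closedBall _ _).lipschitzOnWith_of_nnnorm_fderiv_le
        (fun x _ => hg.differentiable one_ne_zero x) fun x hx => ?_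
      rw [← norm_toNNReal]
      exact Real.toNNReal_le_toNNReal (hC x hx)
    · simp only [NNReal.coe_zero, sub_zero, sub_self]
      rw [max_eq_left (sub_nonneg.2 hab)]
      exact le_rfl
  exact hP.exists_eq_forall_mem_Icc_hasDerivWithinAt₀

/-- A continuous field with values in a finite-dimensional space and compact support is a uniform
limit of bounded smooth fields. -/
theorem exists_contDiff_approx_of_hasCompactSupport {G : E → E} (hG : Continuous G)
    (hs : HasCompactSupport G) {ε : ℝ} (hε : 0 < ε) :
    ∃ g : E → E, ContDiff ℝ 1 g ∧ (∃ M, ∀ z, ‖g z‖ ≤ M) ∧ ∀ z, ‖g z - G z‖ ≤ ε := by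
  obtain ⟨g, hg, hgG⟩ := (hs.uniformContinuous_of_continuous hG).exists_contDiff_dist_le hε
  obtain ⟨C, hC⟩ := hs.exists_bound_of_continuous hG
  refine ⟨g, hg.of_le (by exact_mod_cast le_top), ⟨ε + C, fun z => ?_⟩, fun z => ?_⟩
  · have h1 := hgG z
    rw [dist_eq_norm] at h1
    calc ‖g z‖ = ‖(g z - G z) + G z‖ := by simp
      _ ≤ ‖g z - G z‖ + ‖G z‖ := norm_add_le _ _
      _ ≤ ε + C := add_le_add h1.le (hC z)
  · rw [← dist_eq_norm]; exact (hgG z).le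

/-- A continuous dissipative field has solutions on every compact interval. -/
theorem exists_isSolutionOn_of_monotone {F : E → E} (hc : Continuous F)
    (hF : ∀ z w, ⟪z - w, F z - F w⟫ ≤ 0) {a b : ℝ} (hab : a ≤ b) (z₀ : E) :
    ∃ z : ℝ → E, z a = z₀ ∧ IsSolutionOn F (Icc a b) z := by
  have : CompleteSpace E := FiniteDimensional.complete ℝ E
  have : ProperSpace E := FiniteDimensional.proper ℝ E
  -- Dissipativity against the point `0`, with approximation error at most `1`, gives `2⟪z, g z⟫ ≤
  -- 2C‖z‖ ≤ ‖z‖² + C²`. So `‖z‖² + C²` grows at most like `exp (t - a)`, and `R` is the resulting a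
  -- priori bound.
  set C : ℝ := ‖F 0‖ + 1 with hC
  have hC0 : 0 < C := by positivity
  obtain ⟨R, hR0, hR⟩ : ∃ R : ℝ, 0 < R ∧ (‖z₀‖ ^ 2 + C ^ 2) * Real.exp (b - a) ≤ R ^ 2 :=
    ⟨√((‖z₀‖ ^ 2 + C ^ 2) * Real.exp (b - a)), by positivity, (Real.sq_sqrt (by positivity)).ge⟩
  let φ : ContDiffBump (0 : E) := ⟨R, R + 1, hR0, by linarith⟩
  let G : E → E := fun z => φ z • F z
  have hG : Continuous G := φ.continuous.smul hc
  have hGs : HasCompactSupport G := φ.hasCompactSupport.smul_right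
  have hGF : ∀ z, ‖z‖ ≤ R → G z = F z := fun z hz => by
    simp only [G]
    rw [φ.one_of_mem_closedBall (by simpa using hz), one_smul]
  -- The cutoff may destroy dissipativity, but this radial bound survives because `0 ≤ φ ≤ 1` and
  -- its right side is nonnegative.
  have hGz : ∀ z, ⟪z, G z⟫ ≤ ‖z‖ * ‖F 0‖ := fun z => by
    have h1 : ⟪z, F z⟫ ≤ ‖z‖ * ‖F 0‖ := by
      have h2 := hF z 0
      rw [sub_zero, inner_sub_right] at h2
      linarith [real_inner_le_norm z (F 0)]
    have h3 : ⟪z, G z⟫ = φ z * ⟪z, F z⟫ := by simp [G, inner_smul_right]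
    rw [h3]
    have h4 : 0 ≤ ‖z‖ * ‖F 0‖ := by positivity
    nlinarith [φ.nonneg' z, φ.le_one (x := z)]
  let e : ℕ → ℝ := fun n => 1 / ((n : ℝ) + 1)
  have he0 : ∀ n, 0 < e n := fun n => Nat.one_div_pos_of_nat
  have he1 : ∀ n, e n ≤ 1 := fun n => by
    simp only [e]
    rw [div_le_one (by positivity)]
    linarith [n.cast_nonneg (α := ℝ)]
  have hlim : Tendsto e atTop (𝓝 0) := tendsto_one_div_add_atTop_nhds_zero_nat
  choose g hg hgM hgG using fun n => exists_contDiff_approx_of_hasCompactSupport hG hGs (he0 n)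
  choose M hM using hgM
  choose z hza hz using fun n =>
    exists_isSolutionOn_of_contDiff_of_bounded (hg n) (hM n) hab z₀
  have hbound : ∀ n, ∀ t ∈ Icc a b, ‖z n t‖ ≤ R := by
    intro n t ht
    have hsub : Icc a t ⊆ Icc a b := Icc_subset_Icc_right ht.2
    have h := le_mul_exp_of_hasDerivWithinAt (c := 1) ht.1
      (fun s hs => ((hasDerivWithinAt_norm_sq_clm (.id ℝ E)
        ((hz n s (hsub hs)).mono hsub))).add_const (C ^ 2)) fun s _ => by
        have h1 := hGz (z n s)
        have h2 : ⟪z n s, g n (z n s) - G (z n s)⟫ ≤ ‖z n s‖ * 1 :=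
          (real_inner_le_norm _ _).trans
            (mul_le_mul_of_nonneg_left ((hgG n _).trans (he1 n)) (norm_nonneg _))
        rw [inner_sub_right] at h2
        simp only [ContinuousLinearMap.id_apply]
        nlinarith [sq_nonneg (‖z n s‖ - C)]
    simp only [ContinuousLinearMap.id_apply, hza, one_mul] at h
    have h2 : (‖z₀‖ ^ 2 + C ^ 2) * Real.exp (t - a) ≤ (‖z₀‖ ^ 2 + C ^ 2) * Real.exp (b - a) := by
      have := ht.2
      gcongr
    exact le_of_sq_le_sq (by nlinarith [sq_nonneg C]) hR0.le
  have hgF : ∀ n, ∀ t ∈ Icc a b, ‖g n (z n t) - F (z n t)‖ ≤ e n := fun n t ht => by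
    rw [← hGF _ (hbound n t ht)]; exact hgG n _
  -- Inside the ball of radius `R` the dissipativity of `F` itself is available, so only the errors
  -- `e n`, `e m` contribute to the growth of the squared distance, each multiplied by `‖z n s - z m
  -- s‖ ≤ 2R`.
  have hdist : ∀ n m, ∀ t ∈ Icc a b,
      ‖z n t - z m t‖ ^ 2 ≤ 4 * R * (e n + e m) * (b - a) := by
    intro n m t ht
    have hsub : Icc a t ⊆ Icc a b := Icc_subset_Icc_right ht.2
    have h := le_mul_exp_of_hasDerivWithinAt (c := 0) ht.1
      (fun s hs => (hasDerivWithinAt_norm_sq_clm (.id ℝ E)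
        (((hz n s (hsub hs)).mono hsub).fun_sub ((hz m s (hsub hs)).mono hsub))).sub
        (((hasDerivAt_id s).sub_const a).const_mul (4 * R * (e n + e m))).hasDerivWithinAt)
      fun s hs => by
        have hs' := hsub hs
        have h1 := hF (z n s) (z m s)
        have h2 : ‖z n s - z m s‖ ≤ 2 * R := (norm_sub_le _ _).trans (by
          linarith [hbound n s hs', hbound m s hs'])
        have h3 : ⟪z n s - z m s, g n (z n s) - F (z n s)⟫ ≤ 2 * R * e n :=
          (real_inner_le_norm _ _).trans
            (mul_le_mul h2 (hgF n s hs') (norm_nonneg _) (by positivity))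
        have h4 : -⟪z n s - z m s, g m (z m s) - F (z m s)⟫ ≤ 2 * R * e m :=
          (neg_le_abs _).trans <| (abs_real_inner_le_norm _ _).trans
            (mul_le_mul h2 (hgF m s hs') (norm_nonneg _) (by positivity))
        simp only [ContinuousLinearMap.id_apply]
        rw [inner_sub_right] at h1 h3 h4 ⊢
        linarith
    simp only [ContinuousLinearMap.id_apply, hza, Pi.sub_apply] at h
    simp only [sub_self, norm_zero, id_eq, mul_zero, zero_mul] at h
    have h5 : 4 * R * (e n + e m) * (t - a) ≤ 4 * R * (e n + e m) * (b - a) :=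
      mul_le_mul_of_nonneg_left (by linarith [ht.2])
        (mul_nonneg (by positivity) (add_pos (he0 n) (he0 m)).le)
    nlinarith
  let d : ℕ → ℝ := fun N => √(4 * R * (e N + e N) * (b - a))
  have hd : Tendsto d atTop (𝓝 0) := by
    have h : Tendsto (fun N => 4 * R * (e N + e N) * (b - a)) atTop (𝓝 (4 * R * (0 + 0) * (b - a))) :=
      ((hlim.add hlim).const_mul _).mul_const _
    simpa using h.sqrt
  have hdd : ∀ N n m, N ≤ n → N ≤ m → ∀ t ∈ Icc a b, ‖z n t - z m t‖ ≤ d N := by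
    intro N n m hn hm t ht
    refine Real.le_sqrt_of_sq_le ((hdist n m t ht).trans ?_)
    have h1 : e n ≤ e N := Nat.one_div_le_one_div hn
    have h2 : e m ≤ e N := Nat.one_div_le_one_div hm
    have := sub_nonneg.2 hab
    gcongr
  have hex : ∀ t, ∃ y, t ∈ Icc a b → Tendsto (fun n => z n t) atTop (𝓝 y) := by
    intro t
    by_cases ht : t ∈ Icc a b
    · have hcs : CauchySeq fun n => z n t := cauchySeq_of_le_tendsto_0 d
        (fun n m N hn hm => by rw [dist_eq_norm]; exact hdd N n m hn hm t ht) hd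
      obtain ⟨y, hy⟩ := cauchySeq_tendsto_of_complete hcs
      exact ⟨y, fun _ => hy⟩
    · exact ⟨0, fun h => absurd h ht⟩
  choose y hy using hex
  have hunif : TendstoUniformlyOn z y atTop (Icc a b) := by
    rw [Metric.tendstoUniformlyOn_iff]
    intro ε hε
    filter_upwards [hd.eventually (gt_mem_nhds hε)] with N hN t ht
    rw [dist_comm, dist_eq_norm]
    refine lt_of_le_of_lt (le_of_tendsto ((hy t ht).const_sub (z N t)).norm ?_) hN
    filter_upwards [eventually_ge_atTop N] with m hm
    exact hdd N N m le_rfl hm t ht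
  have hzc : ∀ n, ContinuousOn (z n) (Icc a b) := fun n t ht => (hz n t ht).continuousWithinAt
  have hyc : ContinuousOn y (Icc a b) := hunif.continuousOn (.of_forall hzc)
  obtain ⟨B, hB⟩ := (isCompact_closedBall (0 : E) R).exists_bound_of_continuousOn hc.continuousOn
  -- Uniform convergence does not control derivatives, so the limit is taken in the integral
  -- equation by dominated convergence.
  have hpic : ∀ t ∈ Icc a b, y t = ODE.picard (fun _ => F) a z₀ y t := by
    intro t ht
    have hsub : Icc a t ⊆ Icc a b := Icc_subset_Icc_right ht.2
    have hsub' : uIoc a t ⊆ Icc a b := by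
      rw [uIoc_of_le ht.1]; exact Ioc_subset_Icc_self.trans hsub
    have hn : ∀ n, ∫ s in a..t, g n (z n s) = z n t - z₀ := by
      intro n
      rw [intervalIntegral.integral_eq_sub_of_hasDeriv_right_of_le ht.1 ((hzc n).mono hsub)
        (f' := fun s => g n (z n s)) (fun s hs => ?_) ?_, hza]
      · refine ContinuousOn.intervalIntegrable ?_
        rw [uIcc_of_le ht.1]
        exact (hg n).continuous.comp_continuousOn ((hzc n).mono hsub)
      · exact (hz n s (hsub (Ioo_subset_Icc_self hs))).mono_of_mem_nhdsWithin
          (mem_nhdsWithin_of_mem_nhds (mem_of_superset (Ioo_mem_nhds hs.1 hs.2)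
            (Ioo_subset_Icc_self.trans hsub)))
    have hl1 : Tendsto (fun n => ∫ s in a..t, g n (z n s)) atTop (𝓝 (∫ s in a..t, F (y s))) := by
      refine intervalIntegral.tendsto_integral_filter_of_dominated_convergence (fun _ => 1 + B)
        (.of_forall fun n => ?_) (.of_forall fun n => .of_forall fun s hs => ?_)
        intervalIntegrable_const (.of_forall fun s hs => ?_)
      · exact ((hg n).continuous.comp_continuousOn ((hzc n).mono hsub')).aestronglyMeasurable
          measurableSet_uIoc
      · have h1 := hgF n s (hsub' hs)
        have h2 := hB (z n s) (by simpa using hbound n s (hsub' hs))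
        calc ‖g n (z n s)‖ = ‖(g n (z n s) - F (z n s)) + F (z n s)‖ := by simp
          _ ≤ ‖g n (z n s) - F (z n s)‖ + ‖F (z n s)‖ := norm_add_le _ _
          _ ≤ 1 + B := add_le_add (h1.trans (he1 n)) h2
      · have h1 : Tendsto (fun n => g n (z n s) - F (z n s)) atTop (𝓝 0) :=
          squeeze_zero_norm (fun n => hgF n s (hsub' hs)) hlim
        simpa using h1.add ((hc.tendsto _).comp (hy s (hsub' hs)))
    have hl2 : Tendsto (fun n => ∫ s in a..t, g n (z n s)) atTop (𝓝 (y t - z₀)) := by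
      simp only [hn]
      exact (hy t ht).sub_const z₀
    rw [ODE.picard_apply, tendsto_nhds_unique hl1 hl2]
    abel
  refine ⟨y, ?_, fun t ht => ?_⟩
  · rw [hpic a (left_mem_Icc.2 hab)]; simp
  · exact (ODE.hasDerivWithinAt_picard_Icc (u := univ) (f := fun _ => F) (left_mem_Icc.2 hab)
      (by fun_prop) hyc (fun _ _ => mem_univ _) z₀ ht).congr hpic (hpic t ht)

/-- A continuous dissipative field has a well-defined flow. -/
theorem hasFlow_of_monotone {F : E → E} (hc : Continuous F)
    (hF : ∀ z w, ⟪z - w, F z - F w⟫ ≤ 0) : HasFlow F := by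
  refine ⟨fun t₀ _ z₀ => ?_, fun t₀ _ T z w hz hw h => eqOn_of_monotone hF hz hw h⟩
  choose Z hZ₀ hZ using fun N : ℕ =>
    exists_isSolutionOn_of_monotone hc hF (le_add_of_nonneg_right N.cast_nonneg : t₀ ≤ t₀ + N) z₀
  have hagree : ∀ N M : ℕ, N ≤ M → EqOn (Z N) (Z M) (Icc t₀ (t₀ + N)) := fun N M hNM =>
    eqOn_of_monotone hF (hZ N) ((hZ M).mono (Icc_subset_Icc_right (by simpa using hNM)))
      ((hZ₀ N).trans (hZ₀ M).symm)
  let z : ℝ → E := fun t => Z ⌈t - t₀⌉₊ t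
  have hz : ∀ N : ℕ, EqOn z (Z N) (Icc t₀ (t₀ + N)) := by
    intro N t ht
    have h1 : ⌈t - t₀⌉₊ ≤ N := Nat.ceil_le.2 (by linarith [ht.2])
    exact hagree _ _ h1 ⟨ht.1, by linarith [Nat.le_ceil (t - t₀)]⟩
  refine ⟨z, fun t ht => ?_, ?_⟩
  -- The strict inequality keeps `t` off the right endpoint, so that `Icc t₀ (t₀ + N)` is a
  -- neighbourhood of `t` within `Ici t₀`.
  · obtain ⟨N, hN⟩ := exists_nat_gt (t - t₀)
    have htN : t ∈ Icc t₀ (t₀ + N) := ⟨ht, by linarith⟩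
    have h1 := (hZ N t htN).congr (hz N) (hz N htN)
    rw [← hz N htN] at h1
    refine h1.mono_of_mem_nhdsWithin ?_
    rw [← Ici_inter_Iic]
    exact inter_mem_nhdsWithin _ (Iic_mem_nhds (by linarith))
  · rw [hz 0 (by simp)]
    exact hZ₀ 0

end Existence

/-! ### Gradients of convex functions and monotone fields. -/

section Convexity

variable {E : Type*} [NormedAddCommGroup E] [InnerProductSpace ℝ E]

open scoped RealInnerProductSpace

/-- First-order characterization of convexity. -/
theorem add_inner_gradient_le [CompleteSpace E] {f : E → ℝ} (hf : ConvexOn ℝ univ f)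
    (hd : Differentiable ℝ f) (x y : E) : f x + ⟪gradient f x, y - x⟫ ≤ f y := by
  let γ : ℝ →ᵃ[ℝ] E := AffineMap.lineMap x y
  have hc : ConvexOn ℝ univ (f ∘ γ) := by simpa using hf.comp_affineMap γ
  have hder : HasDerivAt (f ∘ γ) ⟪gradient f x, y - x⟫ 0 := by
    rw [inner_gradient_left]
    have h0 : γ 0 = x := AffineMap.lineMap_apply_zero x y
    have h1 : HasFDerivAt f (fderiv ℝ f x) (γ 0) := h0 ▸ (hd x).hasFDerivAt
    exact h1.comp_hasDerivAt 0 AffineMap.hasDerivAt_lineMap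
  have h := hc.le_slope_of_hasDerivAt (mem_univ 0) (mem_univ 1) one_pos hder
  simp only [slope_def_field, Function.comp_apply, sub_zero, div_one] at h
  rw [AffineMap.lineMap_apply_one, AffineMap.lineMap_apply_zero] at h
  linarith

theorem inner_gradient_sub_nonneg [CompleteSpace E] {f : E → ℝ} (hf : ConvexOn ℝ univ f)
    (hd : Differentiable ℝ f) (x y : E) : 0 ≤ ⟪gradient f x - gradient f y, x - y⟫ := by
  have h1 := add_inner_gradient_le hf hd x y
  have h2 := add_inner_gradient_le hf hd y x
  rw [← neg_sub x y, inner_neg_right] at h1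
  rw [inner_sub_left]
  linarith

/-- The restriction of a vector field to a line. -/
theorem hasDerivAt_inner_line {G : E → E} {x : E} (hG : DifferentiableAt ℝ G x) (v : E) :
    HasDerivAt (fun t : ℝ => ⟪G (x + t • v), v⟫) ⟪fderiv ℝ G x v, v⟫ 0 := by
  have h1 : HasDerivAt (fun t : ℝ => x + t • v) v 0 := by
    simpa using ((hasDerivAt_id (0 : ℝ)).smul_const v).const_add x
  have h2 : HasFDerivAt G (fderiv ℝ G x) (x + (0 : ℝ) • v) := by simpa using hG.hasFDerivAt
  have h3 := (h2.comp_hasDerivAt (0 : ℝ) h1).inner ℝ (hasDerivAt_const (0 : ℝ) v)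
  simpa using h3

theorem monotone_inner_line {G : E → E} {l : ℝ}
    (hG : ∀ x y, l * ‖x - y‖ ^ 2 ≤ ⟪G x - G y, x - y⟫) (x v : E) :
    Monotone fun t : ℝ => ⟪G (x + t • v), v⟫ - l * ‖v‖ ^ 2 * t := by
  intro s t hst
  rcases hst.eq_or_lt with rfl | hst
  · exact le_rfl
  have h := hG (x + t • v) (x + s • v)
  have h1 : (x + t • v) - (x + s • v) = (t - s) • v := by rw [sub_smul]; abel
  rw [h1, inner_smul_right, norm_smul, mul_pow, inner_sub_left, Real.norm_eq_abs, sq_abs] at h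
  have h2 : (t - s) * (l * ‖v‖ ^ 2 * (t - s)) ≤
      (t - s) * (⟪G (x + t • v), v⟫ - ⟪G (x + s • v), v⟫) := by linarith
  have h3 := le_of_mul_le_mul_left h2 (sub_pos.2 hst)
  simp only
  linarith

/-- Differentiating the nondecreasing function of `monotone_inner_line` at `0` carries strong
monotonicity over to the Jacobian. -/
theorem mul_norm_sq_le_inner_fderiv {G : E → E} {l : ℝ}
    (hG : ∀ x y, l * ‖x - y‖ ^ 2 ≤ ⟪G x - G y, x - y⟫) {x : E} (hd : DifferentiableAt ℝ G x)
    (v : E) : l * ‖v‖ ^ 2 ≤ ⟪fderiv ℝ G x v, v⟫ := by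
  have h := ((hasDerivAt_inner_line hd v).sub
    ((hasDerivAt_id (0 : ℝ)).const_mul (l * ‖v‖ ^ 2))).nonneg_of_monotone
    (monotone_inner_line hG x v)
  linarith

/-- A monotone field with positive definite derivative at `x` is strictly monotone at `x`. -/
theorem eq_of_inner_sub_eq_zero {G : E → E} (hG : ∀ x y, 0 ≤ ⟪G x - G y, x - y⟫) {x y : E}
    (hd : DifferentiableAt ℝ G x) (hpos : ∀ v, v ≠ 0 → 0 < ⟪v, fderiv ℝ G x v⟫)
    (h : ⟪G y - G x, y - x⟫ = 0) : y = x := by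
  by_contra hne
  have hv : y - x ≠ 0 := sub_ne_zero.2 hne
  have hmono : Monotone fun t : ℝ => ⟪G (x + t • (y - x)), y - x⟫ := by
    simpa using monotone_inner_line (l := 0) (by simpa using hG) x (y - x)
  -- A monotone function with equal values at `0` and `1` is constant in between, so its derivative
  -- at `0` vanishes, against `hpos`.
  have hconst : EqOn (fun t : ℝ => ⟪G (x + t • (y - x)), y - x⟫) (fun _ => ⟪G x, y - x⟫)
      (Icc 0 1) := by
    intro t ht
    have h0 := hmono ht.1
    have h1 := hmono ht.2
    simp only [zero_smul, add_zero, one_smul, add_sub_cancel] at h0 h1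
    rw [inner_sub_left] at h
    exact le_antisymm (by linarith) h0
  have h1 := (hasDerivAt_inner_line hd (y - x)).hasDerivWithinAt (s := Icc 0 1)
  have h2 := (hasDerivWithinAt_const (0 : ℝ) (Icc 0 1) ⟪G x, y - x⟫).congr hconst
    (hconst (by simp))
  have h3 := (uniqueDiffOn_Icc (zero_lt_one' ℝ) 0 (by simp)).eq_deriv _ h1 h2
  have h4 := hpos _ hv
  rw [real_inner_comm] at h4
  exact h4.ne' h3

end Convexity

/-! ### Matrix measures in weighted Euclidean norms. -/

section MatrixMeasure

variable {E : Type*} [NormedAddCommGroup E]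

/-- `Q` is an isometry from the weighted norm to the original one, so conjugating by it reduces
everything to the ordinary operator norm. -/
theorem inducedNorm_eq_opNorm [NormedSpace ℝ E] (Q : E ≃L[ℝ] E) (M : E →L[ℝ] E) :
    inducedNorm (fun z => ‖Q z‖) M = ‖(Q : E →L[ℝ] E) ∘L M ∘L (Q.symm : E →L[ℝ] E)‖ := by
  rw [ContinuousLinearMap.norm_def]
  refine congrArg sInf (Set.ext fun C => and_congr_right fun _ => ⟨fun h x => ?_, fun h v => ?_⟩)
  · simpa using h (Q.symm x)
  · simpa using h (Q v)

/-- For `s ≤ t`, `I + sB` is a convex combination of `I` and `I + tB`. Monotone quotients that are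
bounded below converge at `0⁺`, which is how the matrix measure is shown to exist. -/
theorem norm_id_add_smul_sub_one_div_monotoneOn [NormedSpace ℝ E] [Nontrivial E]
    (B : E →L[ℝ] E) :
    MonotoneOn (fun h : ℝ => (‖ContinuousLinearMap.id ℝ E + h • B‖ - 1) / h) (Ioi 0) := by
  intro s hs t ht hst
  have hs : 0 < s := hs
  have ht : 0 < t := ht
  have h1 : ContinuousLinearMap.id ℝ E + s • B =
      (1 - s / t) • ContinuousLinearMap.id ℝ E + (s / t) • (ContinuousLinearMap.id ℝ E + t • B) := by
    rw [smul_add, smul_smul, div_mul_cancel₀ _ ht.ne', sub_smul, one_smul]; abel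
  have h2 : s / t ≤ 1 := (div_le_one ht).2 hst
  have h3 : ‖ContinuousLinearMap.id ℝ E + s • B‖ ≤
      (1 - s / t) * 1 + (s / t) * ‖ContinuousLinearMap.id ℝ E + t • B‖ := by
    rw [h1]
    refine (norm_add_le _ _).trans (add_le_add ?_ ?_)
    · rw [norm_smul, ContinuousLinearMap.norm_id, Real.norm_of_nonneg (by linarith)]
    · rw [norm_smul, Real.norm_of_nonneg (by positivity)]
  simp only
  rw [div_le_div_iff₀ hs ht]
  have h4 : t * ‖ContinuousLinearMap.id ℝ E + s • B‖ ≤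
      t * ((1 - s / t) * 1 + (s / t) * ‖ContinuousLinearMap.id ℝ E + t • B‖) :=
    mul_le_mul_of_nonneg_left h3 ht.le
  have h5 : t * ((1 - s / t) * 1 + (s / t) * ‖ContinuousLinearMap.id ℝ E + t • B‖) =
      t - s + s * ‖ContinuousLinearMap.id ℝ E + t • B‖ := by field_simp
  linarith

variable [InnerProductSpace ℝ E]

open scoped RealInnerProductSpace

/-- Expanding the square gives `‖v + hBv‖² ≤ (1 + 2x)‖v‖² ≤ (1 + x)²‖v‖²` with `x = -hc + h²‖B‖²/2`;
the condition `h * c ≤ 1` keeps `1 + x` nonnegative. -/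
theorem norm_id_add_smul_le_of_inner_le {B : E →L[ℝ] E} {c : ℝ}
    (hB : ∀ v, ⟪v, B v⟫ ≤ -c * ‖v‖ ^ 2) {h : ℝ} (hh : 0 < h) (hc : h * c ≤ 1) :
    ‖ContinuousLinearMap.id ℝ E + h • B‖ ≤ 1 - h * c + h ^ 2 * ‖B‖ ^ 2 / 2 := by
  have h0 : 0 ≤ 1 - h * c + h ^ 2 * ‖B‖ ^ 2 / 2 := by
    have : 0 ≤ h ^ 2 * ‖B‖ ^ 2 / 2 := by positivity
    linarith
  refine ContinuousLinearMap.opNorm_le_bound _ h0 fun v => ?_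
  refine le_of_sq_le_sq ?_ (by positivity)
  have h1 : ‖(ContinuousLinearMap.id ℝ E + h • B) v‖ ^ 2 =
      ‖v‖ ^ 2 + 2 * (h * ⟪v, B v⟫) + h ^ 2 * ‖B v‖ ^ 2 := by
    simp only [add_apply, ContinuousLinearMap.id_apply,
      smul_apply]
    rw [norm_add_sq_real, inner_smul_right, norm_smul, mul_pow, Real.norm_eq_abs, sq_abs]
  have h2 : ‖B v‖ ^ 2 ≤ ‖B‖ ^ 2 * ‖v‖ ^ 2 := by
    rw [← mul_pow]; exact pow_le_pow_left₀ (norm_nonneg _) (B.le_opNorm v) 2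
  have h3 : h * ⟪v, B v⟫ ≤ h * (-c * ‖v‖ ^ 2) := mul_le_mul_of_nonneg_left (hB v) hh.le
  have h4 : h ^ 2 * ‖B v‖ ^ 2 ≤ h ^ 2 * (‖B‖ ^ 2 * ‖v‖ ^ 2) :=
    mul_le_mul_of_nonneg_left h2 (sq_nonneg h)
  rw [h1]
  have h5 : 0 ≤ (h * c - h ^ 2 * ‖B‖ ^ 2 / 2) ^ 2 * ‖v‖ ^ 2 := by positivity
  nlinarith

/-- The logarithmic norm of an operator exists, and is bounded by its numerical range. -/
theorem exists_tendsto_norm_id_add_smul_sub_one_div [Nontrivial E] {B : E →L[ℝ] E} {c : ℝ}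
    (hB : ∀ v, ⟪v, B v⟫ ≤ -c * ‖v‖ ^ 2) :
    ∃ m, Tendsto (fun h : ℝ => (‖ContinuousLinearMap.id ℝ E + h • B‖ - 1) / h)
      (𝓝[>] 0) (𝓝 m) ∧ m ≤ -c := by
  have hbdd : BddBelow ((fun h : ℝ => (‖ContinuousLinearMap.id ℝ E + h • B‖ - 1) / h) '' Ioi 0) := by
    refine ⟨-‖B‖, ?_⟩
    rintro _ ⟨h, hh, rfl⟩
    have hh : 0 < h := hh
    simp only
    rw [le_div_iff₀ hh]
    have h1 : ‖ContinuousLinearMap.id ℝ E‖ ≤ ‖ContinuousLinearMap.id ℝ E + h • B‖ + ‖h • B‖ := by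
      simpa using norm_sub_le (ContinuousLinearMap.id ℝ E + h • B) (h • B)
    rw [ContinuousLinearMap.norm_id, norm_smul, Real.norm_of_nonneg hh.le] at h1
    linarith
  have hlim := (norm_id_add_smul_sub_one_div_monotoneOn B).tendsto_nhdsGT hbdd
  refine ⟨_, hlim, ?_⟩
  have hlim2 : Tendsto (fun h : ℝ => -c + h * (‖B‖ ^ 2 / 2)) (𝓝[>] 0) (𝓝 (-c)) := by
    have h : Tendsto (fun h : ℝ => -c + h * (‖B‖ ^ 2 / 2)) (𝓝 0) (𝓝 (-c + 0 * (‖B‖ ^ 2 / 2))) :=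
      (tendsto_id.mul_const _).const_add _
    rw [zero_mul, add_zero] at h
    exact h.mono_left nhdsWithin_le_nhds
  refine le_of_tendsto_of_tendsto hlim hlim2 ?_
  have hsmall : ∀ᶠ h : ℝ in 𝓝[>] 0, h * c < 1 := by
    have h : Tendsto (fun h : ℝ => h * c) (𝓝 0) (𝓝 (0 * c)) := tendsto_id.mul_const _
    rw [zero_mul] at h
    exact nhdsWithin_le_nhds (h.eventually (gt_mem_nhds one_pos))
  filter_upwards [hsmall, self_mem_nhdsWithin] with h h1 hh
  have hh : 0 < h := hh
  rw [div_le_iff₀ hh]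
  have := norm_id_add_smul_le_of_inner_le hB hh h1.le
  linarith

theorem exists_hasMatrixMeasure_le [Nontrivial E] (Q : E ≃L[ℝ] E) {M : E →L[ℝ] E} {c : ℝ}
    (hM : ∀ v, ⟪Q v, Q (M v)⟫ ≤ -c * ‖Q v‖ ^ 2) :
    ∃ m, HasMatrixMeasure (fun z => ‖Q z‖) M m ∧ m ≤ -c := by
  obtain ⟨m, hm, hmc⟩ := exists_tendsto_norm_id_add_smul_sub_one_div
    (B := (Q : E →L[ℝ] E) ∘L M ∘L (Q.symm : E →L[ℝ] E)) (c := c)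
    fun v => by simpa using hM (Q.symm v)
  refine ⟨m, hm.congr fun h => ?_, hmc⟩
  rw [inducedNorm_eq_opNorm]
  congr 3
  ext v
  simp

end MatrixMeasure

/-! ### Stability of equilibria from contraction. -/

section Stability

variable {E : Type*} [NormedAddCommGroup E]

theorem IsTrajectory.shift [NormedSpace ℝ E] {F : E → E} {a b s : ℝ} {z : ℝ → E}
    (hz : IsTrajectory F a z) (h : a ≤ b + s) : IsTrajectory F b fun t => z (t + s) := by
  intro t ht
  have ht' : b ≤ t := ht
  have h1 := (hz (t + s) (h.trans (by linarith) : a ≤ t + s)).scomp t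
    (((hasDerivAt_id t).add_const s).hasDerivWithinAt (s := Ici b)) fun u hu => by
      have : b ≤ u := hu
      exact (h.trans (by simpa using this) : a ≤ u + s)
  simpa [Function.comp_def] using h1

theorem isTrajectory_const [NormedSpace ℝ E] {F : E → E} {zs : E} (h : IsEquilibrium F zs)
    (t₀ : ℝ) : IsTrajectory F t₀ fun _ => zs := fun t _ => by
  have h0 : F zs = 0 := h
  simpa [h0] using hasDerivWithinAt_const t (Ici t₀) zs

/-- If the values of a function stay constant along a trajectory, the derivative vanishes. -/
theorem deriv_eq_zero_of_const [NormedSpace ℝ E] {g : ℝ → E} {g' y : E} {a t : ℝ}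
    (hg : HasDerivWithinAt g g' (Ici a) t) (ht : a ≤ t) (hy : ∀ s, a ≤ s → g s = y) : g' = 0 :=
  (uniqueDiffOn_Ici a t ht).eq_deriv _ hg
    ((hasDerivWithinAt_const t (Ici a) y).congr (fun s hs => hy s hs) (hy t ht))

variable [InnerProductSpace ℝ E]

open scoped RealInnerProductSpace

/-- **LaSalle's invariance principle** for dissipative fields. -/
theorem globallyAsymptoticallyStable_of_monotone [FiniteDimensional ℝ E] {F : E → E}
    (hc : Continuous F) (hF : ∀ z w, ⟪z - w, F z - F w⟫ ≤ 0) {zs : E} (hzs : IsEquilibrium F zs)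
    (hinv : ∀ t₀ w, IsTrajectory F t₀ w → (∀ t, t₀ ≤ t → ⟪w t - zs, F (w t)⟫ = 0) → w t₀ = zs) :
    GloballyAsymptoticallyStable F zs := by
  have hcontr : ∀ t₀ z w, IsTrajectory F t₀ z → IsTrajectory F t₀ w → ∀ s t, t₀ ≤ s → s ≤ t →
      ‖z t - w t‖ ≤ ‖z s - w s‖ := fun t₀ z w hz hw s t hs hst =>
    norm_sub_le_of_monotone hF hst (IsSolutionOn.mono hz fun u hu => hs.trans hu.1)
      (IsSolutionOn.mono hw fun u hu => hs.trans hu.1)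
  refine ⟨fun ε hε => ⟨ε, hε, fun t₀ _ z hz hlt t ht =>
    (hcontr t₀ z _ hz (isTrajectory_const hzs t₀) t₀ t le_rfl ht).trans_lt hlt⟩,
    fun t₀ ht₀ z hz => ?_⟩
  have hdec : ∀ s t, t₀ ≤ s → s ≤ t → ‖z t - zs‖ ≤ ‖z s - zs‖ :=
    hcontr t₀ z _ hz (isTrajectory_const hzs t₀)
  have : ProperSpace E := FiniteDimensional.proper ℝ E
  obtain ⟨p, -, φ, hφ, hp⟩ := (isCompact_closedBall zs ‖z t₀ - zs‖).tendsto_subseq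
    (x := fun n : ℕ => z (t₀ + n)) fun n => by
      rw [Metric.mem_closedBall, dist_eq_norm]
      exact hdec t₀ _ le_rfl (by simp)
  obtain ⟨w, hw, hw₀⟩ := (hasFlow_of_monotone hc hF).1 t₀ ht₀ p
  have hφt : Tendsto (fun n => t₀ + (φ n : ℝ)) atTop atTop :=
    tendsto_atTop_add_const_left _ _ (tendsto_natCast_atTop_atTop.comp hφ.tendsto_atTop)
  -- Time translates of `z` are trajectories whose initial values tend to `p`; contraction makes
  -- them converge to the trajectory `w` from `p`.
  have hwlim : ∀ t, t₀ ≤ t → Tendsto (fun n => z (t + φ n)) atTop (𝓝 (w t)) := by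
    intro t ht
    rw [tendsto_iff_norm_sub_tendsto_zero]
    refine squeeze_zero (fun _ => norm_nonneg _) (fun n => ?_)
      (tendsto_iff_norm_sub_tendsto_zero.1 hp)
    have h := hcontr t₀ (fun t => z (t + φ n)) w (hz.shift (by simp)) hw t₀ t le_rfl ht
    rwa [hw₀] at h
  -- The distance from `z` to `zs` is nonincreasing, so it has a single limit, shared by all limit
  -- points of `z`.
  have hwr : ∀ t, t₀ ≤ t → ‖w t - zs‖ = ‖p - zs‖ := by
    intro t ht
    have h1 := ((hwlim t ht).sub_const zs).norm
    have h2 := (hp.sub_const zs).norm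
    refine le_antisymm (le_of_tendsto_of_tendsto h1 h2 (.of_forall fun n => ?_)) ?_
    · exact hdec _ _ (by simp) (by simpa using ht)
    · refine ge_of_tendsto h1 (.of_forall fun n => ?_)
      refine le_of_tendsto h2 ?_
      filter_upwards [hφt.eventually_ge_atTop (t + φ n)] with m hm
      exact hdec _ _ (ht.trans (by simp)) hm
  have hpz : p = zs := by
    rw [← hw₀]
    refine hinv t₀ w hw fun t ht => ?_
    have h1 := ((hw t ht).sub_const zs).norm_sq
    have h2 := deriv_eq_zero_of_const h1 ht (y := ‖p - zs‖ ^ 2) fun s hs => by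
      simp only [hwr s hs]
    linarith
  -- Since the distance is nonincreasing, convergence along the subsequence gives full convergence.
  rw [tendsto_iff_norm_sub_tendsto_zero, Metric.tendsto_atTop]
  intro ε hε
  have hp0 := (hp.sub_const zs).norm
  rw [hpz, sub_self, norm_zero] at hp0
  obtain ⟨n, hn⟩ := (hp0.eventually (gt_mem_nhds hε)).exists
  refine ⟨t₀ + φ n, fun t ht => ?_⟩
  rw [Real.dist_eq, sub_zero, abs_of_nonneg (norm_nonneg _)]
  exact (hdec _ _ (by simp) ht).trans_lt hn

/-- A strongly contractive flow has a globally exponentially stable equilibrium. -/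
theorem FlowContracts.exists_equilibrium [CompleteSpace E] {F : E → E} {Q : E ≃L[ℝ] E} {c : ℝ}
    (hc : 0 < c) (hF : FlowContracts (fun z => ‖Q z‖) c F) :
    ∃ zs, IsEquilibrium F zs ∧ (∀ w, IsEquilibrium F w → w = zs) ∧
      GloballyExponentiallyStable F zs := by
  obtain ⟨hflow, hcon⟩ := hF
  have hr0 : 0 ≤ Real.exp (-c) := (Real.exp_pos _).le
  have hr1 : Real.exp (-c) < 1 := Real.exp_lt_one_iff.2 (by linarith)
  -- Any starting point would do: comparing `z` with its unit time shift shows that the samples `z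
  -- n` have geometrically decreasing steps. The trajectory from their limit turns out to be
  -- constant.
  obtain ⟨z, hz, -⟩ := hflow.1 0 le_rfl 0
  have hshift : ∀ s, 0 ≤ s → ∀ n : ℕ,
      ‖Q (z (n + s) - z n)‖ ≤ ‖Q (z (0 + s) - z 0)‖ * Real.exp (-c) ^ n := by
    intro s hs n
    have h := hcon 0 le_rfl (fun t => z (t + s)) z (hz.shift (by simpa using hs)) hz n (by simp)
    rwa [sub_zero, mul_comm (-c), Real.exp_nat_mul] at h
  obtain ⟨q, hq⟩ : ∃ q, Tendsto (fun n : ℕ => Q (z n)) atTop (𝓝 q) := by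
    refine cauchySeq_tendsto_of_complete
      (cauchySeq_of_le_geometric (Real.exp (-c)) ‖Q (z (0 + 1) - z 0)‖ hr1 fun n => ?_)
    rw [dist_comm, dist_eq_norm, ← map_sub]
    simpa using hshift 1 zero_le_one n
  have hp : Tendsto (fun n : ℕ => z n) atTop (𝓝 (Q.symm q)) := by
    simpa [Function.comp_def] using (Q.symm.continuous.tendsto q).comp hq
  obtain ⟨w, hw, hw₀⟩ := hflow.1 0 le_rfl (Q.symm q)
  have hQ : Tendsto (fun n : ℕ => Q (z n - Q.symm q)) atTop (𝓝 0) := by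
    simpa using hq.sub_const q
  have hwc : ∀ s, 0 ≤ s → w s = Q.symm q := by
    intro s hs
    have h1 : Tendsto (fun n : ℕ => Q (z (n + s) - w s)) atTop (𝓝 0) := by
      refine squeeze_zero_norm (fun n => ?_) (tendsto_zero_iff_norm_tendsto_zero.1 hQ)
      have h := hcon 0 le_rfl (fun t => z (t + n)) w (hz.shift (by simp)) hw s hs
      simp only [zero_add, hw₀] at h
      rw [add_comm s] at h
      refine h.trans (mul_le_of_le_one_right (norm_nonneg _) (Real.exp_le_one_iff.2 ?_))
      nlinarith
    have h2 : Tendsto (fun n : ℕ => Q (z (n + s) - z n)) atTop (𝓝 0) := by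
      refine squeeze_zero_norm (hshift s hs) ?_
      simpa using (tendsto_pow_atTop_nhds_zero_of_lt_one hr0 hr1).const_mul
        ‖Q (z (0 + s) - z 0)‖
    have h3 : Tendsto (fun _ : ℕ => Q (w s - Q.symm q)) atTop (𝓝 (0 - 0 + 0)) :=
      ((h2.sub h1).add hQ).congr fun n => by simp only [map_sub]; abel
    have h4 := tendsto_nhds_unique tendsto_const_nhds h3
    rw [sub_zero, add_zero, map_eq_zero_iff Q Q.injective, sub_eq_zero] at h4
    exact h4
  have hF0 : IsEquilibrium F (Q.symm q) := by
    have := deriv_eq_zero_of_const (hw 0 (mem_Ici.2 le_rfl)) le_rfl hwc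
    rwa [hw₀] at this
  have hgc : ∀ zs, IsEquilibrium F zs → ∀ t₀ : ℝ, 0 ≤ t₀ → ∀ z : ℝ → E, IsTrajectory F t₀ z →
      ∀ t, t₀ ≤ t → ‖Q (z t - zs)‖ ≤ ‖Q (z t₀ - zs)‖ * Real.exp (-c * (t - t₀)) :=
    fun zs hzs t₀ ht₀ z hz t ht => hcon t₀ ht₀ z _ hz (isTrajectory_const hzs t₀) t ht
  -- The product of norms converts between the two norms; the `+ 1` only secures positivity.
  refine ⟨Q.symm q, hF0, fun v hv => ?_, ‖(Q.symm : E →L[ℝ] E)‖ * ‖(Q : E →L[ℝ] E)‖ + 1, c,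
    by positivity, hc, fun t₀ ht₀ z hz t ht => ?_⟩
  · have h := hgc _ hF0 0 le_rfl _ (isTrajectory_const hv 0) 1 zero_le_one
    have h1 : Real.exp (-c * (1 - 0)) < 1 := by simpa using hr1
    have h2 : ‖Q (v - Q.symm q)‖ = 0 := by
      by_contra hne
      have hpos := lt_of_le_of_ne (norm_nonneg (Q (v - Q.symm q))) (Ne.symm hne)
      nlinarith
    rwa [norm_eq_zero, map_eq_zero_iff Q Q.injective, sub_eq_zero] at h2
  · have h := hgc _ hF0 t₀ ht₀ z hz t ht
    have h1 : ‖z t - Q.symm q‖ ≤ ‖(Q.symm : E →L[ℝ] E)‖ * ‖Q (z t - Q.symm q)‖ := by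
      simpa using (Q.symm : E →L[ℝ] E).le_opNorm (Q (z t - Q.symm q))
    have h2 : ‖Q (z t₀ - Q.symm q)‖ ≤ ‖(Q : E →L[ℝ] E)‖ * ‖z t₀ - Q.symm q‖ :=
      (Q : E →L[ℝ] E).le_opNorm _
    calc ‖z t - Q.symm q‖
        ≤ ‖(Q.symm : E →L[ℝ] E)‖ *
          (‖(Q : E →L[ℝ] E)‖ * ‖z t₀ - Q.symm q‖ * Real.exp (-c * (t - t₀))) :=
          h1.trans (by gcongr; exact h.trans (by gcongr))
      _ = ‖(Q.symm : E →L[ℝ] E)‖ * ‖(Q : E →L[ℝ] E)‖ * ‖z t₀ - Q.symm q‖ *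
          Real.exp (-c * (t - t₀)) := by ring
      _ ≤ _ := by gcongr; linarith

end Stability

/-! ### Positivity of the weighted quadratic form. -/

section WeightedForm

variable {E F : Type*} [NormedAddCommGroup E] [InnerProductSpace ℝ E] [NormedAddCommGroup F]
  [InnerProductSpace ℝ F]

open scoped RealInnerProductSpace

/-- The weighted quadratic form is positive definite. -/
theorem saddle_form_pos {T : E →ₗ[ℝ] F} {s α : ℝ} (hα : 0 ≤ α) (hαs : α * s < 1)
    {u : E} {v : F} (hTu : ‖T u‖ ≤ s * ‖u‖) (h : u ≠ 0 ∨ v ≠ 0) :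
    0 < ‖u‖ ^ 2 + ‖v‖ ^ 2 + 2 * α * ⟪T u, v⟫ := by
  have h1 : -⟪T u, v⟫ ≤ s * ‖u‖ * ‖v‖ :=
    (neg_le_abs _).trans <| (abs_real_inner_le_norm _ _).trans
      (mul_le_mul_of_nonneg_right hTu (norm_nonneg _))
  have h2 := mul_le_mul_of_nonneg_left h1 hα
  have h3 : α * s * (‖u‖ * ‖v‖) ≤ 1 * (‖u‖ * ‖v‖) :=
    mul_le_mul_of_nonneg_right hαs.le (by positivity)
  rcases (mul_nonneg (norm_nonneg u) (norm_nonneg v)).eq_or_lt with h0 | h0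
  · have : 0 < ‖u‖ ^ 2 + ‖v‖ ^ 2 := by
      rcases h with h | h
      · have := norm_pos_iff.2 h; positivity
      · have := norm_pos_iff.2 h; positivity
    nlinarith
  · have h4 : α * s * (‖u‖ * ‖v‖) < 1 * (‖u‖ * ‖v‖) := mul_lt_mul_of_pos_right hαs h0
    nlinarith [sq_nonneg (‖u‖ - ‖v‖)]

end WeightedForm

/-! ### Singular value bounds and the dissipation inequality. -/

section SingularValues

variable {E F : Type*} [NormedAddCommGroup E] [InnerProductSpace ℝ E] [FiniteDimensional ℝ E]
  [NormedAddCommGroup F] [InnerProductSpace ℝ F] [FiniteDimensional ℝ F]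

open scoped RealInnerProductSpace

open Module

/-- Coordinates of `T† T x` in a basis of right singular vectors. -/
theorem repr_adjoint_comp_self (T : E →ₗ[ℝ] F) (x : E) (i : Fin (finrank ℝ E)) :
    (T.isSymmetric_adjoint_comp_self.eigenvectorBasis rfl).repr (T.adjoint (T x)) i =
      T.singularValues i ^ 2 *
        (T.isSymmetric_adjoint_comp_self.eigenvectorBasis rfl).repr x i := by
  rw [T.sq_singularValues_fin rfl i]
  exact T.isSymmetric_adjoint_comp_self.eigenvectorBasis_apply_self_apply rfl x i

theorem norm_map_sq_eq_sum (T : E →ₗ[ℝ] F) (x : E) :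
    ‖T x‖ ^ 2 = ∑ i : Fin (finrank ℝ E), T.singularValues i ^ 2 *
      (T.isSymmetric_adjoint_comp_self.eigenvectorBasis rfl).repr x i ^ 2 := by
  rw [← real_inner_self_eq_norm_sq, ← T.adjoint_inner_left,
    ← (T.isSymmetric_adjoint_comp_self.eigenvectorBasis rfl).repr.inner_map_map, PiLp.inner_apply]
  refine Finset.sum_congr rfl fun i _ => ?_
  rw [repr_adjoint_comp_self]
  simp only [RCLike.inner_apply, conj_trivial]
  ring

/-- The factor `σᵢ⁴` is split as `σᵢ² * σᵢ²` to permit a termwise comparison with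
`norm_map_sq_eq_sum`. -/
theorem norm_adjoint_map_sq_eq_sum (T : E →ₗ[ℝ] F) (x : E) :
    ‖T.adjoint (T x)‖ ^ 2 = ∑ i : Fin (finrank ℝ E), T.singularValues i ^ 2 *
      (T.singularValues i ^ 2 *
        (T.isSymmetric_adjoint_comp_self.eigenvectorBasis rfl).repr x i ^ 2) := by
  rw [← (T.isSymmetric_adjoint_comp_self.eigenvectorBasis rfl).repr.norm_map,
    EuclideanSpace.norm_sq_eq]
  refine Finset.sum_congr rfl fun i _ => ?_
  rw [repr_adjoint_comp_self, Real.norm_eq_abs, sq_abs]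
  ring

theorem norm_map_le_singularValues_zero (T : E →ₗ[ℝ] F) (x : E) :
    ‖T x‖ ≤ T.singularValues 0 * ‖x‖ := by
  refine le_of_sq_le_sq ?_ (mul_nonneg (T.singularValues_nonneg 0) (norm_nonneg _))
  rw [norm_map_sq_eq_sum, mul_pow,
    ← (T.isSymmetric_adjoint_comp_self.eigenvectorBasis rfl).repr.norm_map x,
    EuclideanSpace.norm_sq_eq, Finset.mul_sum]
  refine Finset.sum_le_sum fun i _ => ?_
  rw [Real.norm_eq_abs, sq_abs]
  exact mul_le_mul_of_nonneg_right (pow_le_pow_left₀ (T.singularValues_nonneg i)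
    (T.singularValues_antitone (Nat.zero_le i)) 2) (sq_nonneg _)

/-- The smallest nonzero singular value bounds the adjoint of a surjective map from below. -/
theorem singularValues_mul_norm_le_norm_adjoint {T : E →ₗ[ℝ] F} (hT : Function.Surjective T)
    (y : F) : T.singularValues (finrank ℝ F - 1) * ‖y‖ ≤ ‖T.adjoint y‖ := by
  obtain ⟨x, rfl⟩ := hT y
  refine le_of_sq_le_sq ?_ (norm_nonneg _)
  rw [mul_pow, norm_map_sq_eq_sum, norm_adjoint_map_sq_eq_sum, Finset.mul_sum]
  refine Finset.sum_le_sum fun i _ => ?_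
  -- Below the rank `σᵢ` dominates the last nonzero singular value; from the rank on, both terms
  -- vanish.
  rcases lt_or_ge (i : ℕ) (finrank ℝ F) with hi | hi
  · exact mul_le_mul_of_nonneg_right (pow_le_pow_left₀ (T.singularValues_nonneg _)
      (T.singularValues_antitone (Nat.le_sub_one_of_lt hi)) 2) (by positivity)
  · have : T.singularValues i = 0 := by
      rw [T.singularValues_eq_zero_iff_le_finrank_range, LinearMap.range_eq_top.2 hT, finrank_top]
      exact hi
    simp [this]

theorem singularValues_pos_of_surjective {T : E →ₗ[ℝ] F} (hT : Function.Surjective T) {i : ℕ}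
    (hi : i < finrank ℝ F) : 0 < T.singularValues i := by
  rw [T.singularValues_pos_iff_lt_finrank_range, LinearMap.range_eq_top.2 hT, finrank_top]
  exact hi

/-- The dissipation inequality behind the contraction of primal-dual dynamics: here `u` and `v` are
the primal and dual displacements, and `h` is the displacement of the gradient. -/
theorem saddle_dissipation {T : E →ₗ[ℝ] F} {s m a L α : ℝ} (hs : 0 ≤ s) (hm : 0 ≤ m)
    (hα : 0 ≤ α) (hαs : α * s ≤ 1) (ha : α * (s ^ 2 + 3 / 4 * s * m ^ 2 + L ^ 2) ≤ a)
    {u h : E} {v : F} (hTu : ‖T u‖ ≤ s * ‖u‖) (hTv : m * ‖v‖ ≤ ‖T.adjoint v‖)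
    (hL : ‖h‖ ≤ L * ‖u‖) (hu : a * ‖u‖ ^ 2 ≤ ⟪h, u⟫) :
    -⟪h, u⟫ - α * ⟪h, T.adjoint v⟫ - α * ‖T.adjoint v‖ ^ 2 + α * ‖T u‖ ^ 2 ≤
      -(α * (3 / 4) * (s * m ^ 2 / (s + 1))) * (‖u‖ ^ 2 + ‖v‖ ^ 2 + 2 * α * ⟪T u, v⟫) := by
  -- The rate is `κ * s`. Of the dual budget `κ (s + 1)‖v‖²`, the diagonal term uses `κ s‖v‖²` and
  -- the cross term `κ‖v‖²`.
  obtain ⟨κ, hκ⟩ : ∃ κ, κ = α * (3 / 4) * m ^ 2 / (s + 1) := ⟨_, rfl⟩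
  have hκ0 : 0 ≤ κ := by rw [hκ]; positivity
  have hκs : κ * (s + 1) = α * (3 / 4) * m ^ 2 := by rw [hκ]; field_simp
  have hc : α * (3 / 4) * (s * m ^ 2 / (s + 1)) = κ * s := by rw [hκ]; ring
  rw [hc]
  -- Young's inequality spends a quarter of `‖T.adjoint v‖²`; the rest is the source of the `3 / 4`
  -- in the rate.
  have h1 : -⟪h, T.adjoint v⟫ ≤ L ^ 2 * ‖u‖ ^ 2 + 1 / 4 * ‖T.adjoint v‖ ^ 2 := by
    have := (neg_le_abs _).trans (abs_real_inner_le_norm h (T.adjoint v))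
    have h2 : ‖h‖ ^ 2 ≤ (L * ‖u‖) ^ 2 := pow_le_pow_left₀ (norm_nonneg _) hL 2
    nlinarith [sq_nonneg (‖h‖ - 1 / 2 * ‖T.adjoint v‖)]
  have h1' := mul_le_mul_of_nonneg_left h1 hα
  have h2 : α * ‖T u‖ ^ 2 ≤ α * (s ^ 2 * ‖u‖ ^ 2) := by
    rw [← mul_pow]
    exact mul_le_mul_of_nonneg_left (pow_le_pow_left₀ (norm_nonneg _) hTu 2) hα
  have h3 : α * (3 / 4) * m ^ 2 * ‖v‖ ^ 2 ≤ α * (3 / 4) * ‖T.adjoint v‖ ^ 2 := by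
    rw [mul_assoc (α * (3 / 4)), ← mul_pow]
    exact mul_le_mul_of_nonneg_left
      (pow_le_pow_left₀ (mul_nonneg hm (norm_nonneg _)) hTv 2) (by positivity)
  have h4 := mul_le_mul_of_nonneg_right ha (sq_nonneg ‖u‖)
  have h5 : ⟪T u, v⟫ ≤ s * ‖u‖ * ‖v‖ :=
    (real_inner_le_norm _ _).trans (mul_le_mul_of_nonneg_right hTu (norm_nonneg _))
  have h6 : κ * s * (2 * α * ⟪T u, v⟫) ≤ κ * ((s * ‖u‖) ^ 2 + ‖v‖ ^ 2) := by
    have e1 : κ * s * (2 * α) * ⟪T u, v⟫ ≤ κ * s * (2 * α) * (s * ‖u‖ * ‖v‖) :=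
      mul_le_mul_of_nonneg_left h5 (by positivity)
    have e2 : α * s * (2 * (κ * (s * ‖u‖ * ‖v‖))) ≤ 1 * (2 * (κ * (s * ‖u‖ * ‖v‖))) :=
      mul_le_mul_of_nonneg_right hαs (by positivity)
    have e3 : 0 ≤ κ * (s * ‖u‖ - ‖v‖) ^ 2 := by positivity
    linarith
  -- The middle summand in the denominator of `alphaEps` pays exactly for the primal share of the
  -- weighted norm; `s ^ 2` pays for `‖T u‖²` and `L ^ 2` for `‖h‖²`.
  have h7 : α * (3 / 4 * s * m ^ 2) * ‖u‖ ^ 2 = (κ * s ^ 2 + κ * s) * ‖u‖ ^ 2 := by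
    have : α * (3 / 4 * s * m ^ 2) = s * (κ * (s + 1)) := by rw [hκs]; ring
    rw [this]; ring
  rw [← hκs] at h3
  linarith

end SingularValues

/-! ### Block structure of the state space and the weight `P`. -/

section StateSpace

variable {n k : ℕ}

open scoped RealInnerProductSpace

/-- `primal` as a continuous linear map. -/
def primalCLM (n k : ℕ) : State n k →L[ℝ] EuclideanSpace ℝ (Fin n) :=
  LinearMap.toContinuousLinearMap
    { toFun := primal, map_add' := fun _ _ => rfl, map_smul' := fun _ _ => rfl }

/-- `dual` as a continuous linear map. -/
def dualCLM (n k : ℕ) : State n k →L[ℝ] EuclideanSpace ℝ (Fin k) :=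
  LinearMap.toContinuousLinearMap
    { toFun := dual, map_add' := fun _ _ => rfl, map_smul' := fun _ _ => rfl }

/-- `pair` as a continuous linear map. -/
def pairCLM (n k : ℕ) :
    EuclideanSpace ℝ (Fin n) × EuclideanSpace ℝ (Fin k) →L[ℝ] State n k :=
  LinearMap.toContinuousLinearMap
    { toFun := fun p => pair p.1 p.2
      map_add' := fun _ _ => by ext (i | i) <;> rfl
      map_smul' := fun _ _ => by ext (i | i) <;> rfl }

@[simp] theorem primalCLM_apply (z : State n k) : primalCLM n k z = primal z := rfl

theorem primal_sub (z w : State n k) : primal (z - w) = primal z - primal w := rfl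

theorem dual_sub (z w : State n k) : dual (z - w) = dual z - dual w := rfl

theorem primal_zero : primal (0 : State n k) = 0 := rfl

theorem dual_zero : dual (0 : State n k) = 0 := rfl

theorem state_ext {z w : State n k} (h₁ : primal z = primal w) (h₂ : dual z = dual w) :
    z = w := by
  ext (i | i)
  · exact congrArg (fun x : EuclideanSpace ℝ (Fin n) => x i) h₁
  · exact congrArg (fun x : EuclideanSpace ℝ (Fin k) => x i) h₂

theorem inner_state (z w : State n k) :
    ⟪z, w⟫ = ⟪primal z, primal w⟫ + ⟪dual z, dual w⟫ := by
  simp only [PiLp.inner_apply, Fintype.sum_sum_type]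
  rfl

theorem toEuclideanLin_transpose (A : Matrix (Fin k) (Fin n) ℝ) :
    A.transpose.toEuclideanLin = A.toEuclideanLin.adjoint := by
  rw [← Matrix.toEuclideanLin_conjTranspose_eq_adjoint,
    Matrix.conjTranspose_eq_transpose_of_trivial]

theorem toEuclideanLin_surjective {A : Matrix (Fin k) (Fin n) ℝ} (hA : A.rank = k) :
    Function.Surjective A.toEuclideanLin := by
  rw [← LinearMap.range_eq_top]
  refine Submodule.eq_top_of_finrank_eq ?_
  rw [finrank_euclideanSpace_fin]
  rw [Matrix.rank_eq_finrank_range_toLin A (PiLp.basisFun 2 ℝ (Fin k))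
    (PiLp.basisFun 2 ℝ (Fin n))] at hA
  exact hA

theorem adjoint_toEuclideanLin_injective {A : Matrix (Fin k) (Fin n) ℝ} (hA : A.rank = k) :
    Function.Injective A.toEuclideanLin.adjoint := by
  rw [injective_iff_map_eq_zero]
  intro v hv
  obtain ⟨x, rfl⟩ := toEuclideanLin_surjective hA v
  have h := A.toEuclideanLin.adjoint_inner_left x (A.toEuclideanLin x)
  rw [hv, inner_zero_left] at h
  exact inner_self_eq_zero.1 h.symm

theorem primal_weightP (A : Matrix (Fin k) (Fin n) ℝ) (α : ℝ) (z : State n k) :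
    primal ((weightP A α).toEuclideanLin z) =
      primal z + α • A.toEuclideanLin.adjoint (dual z) := by
  rw [← toEuclideanLin_transpose]
  ext i
  simp [primal, dual, weightP, Matrix.toLpLin_apply, Matrix.mulVec, dotProduct,
    Fintype.sum_sum_type, Matrix.one_apply, Finset.mul_sum, mul_assoc]

theorem dual_weightP (A : Matrix (Fin k) (Fin n) ℝ) (α : ℝ) (z : State n k) :
    dual ((weightP A α).toEuclideanLin z) = dual z + α • A.toEuclideanLin (primal z) := by
  ext i
  simp [primal, dual, weightP, Matrix.toLpLin_apply, Matrix.mulVec, dotProduct,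
    Fintype.sum_sum_type, Matrix.one_apply, Finset.mul_sum, mul_assoc, add_comm]

theorem inner_weightP (A : Matrix (Fin k) (Fin n) ℝ) (α : ℝ) (z w : State n k) :
    ⟪z, (weightP A α).toEuclideanLin w⟫ = ⟪primal z, primal w⟫ + ⟪dual z, dual w⟫ +
      α * (⟪A.toEuclideanLin (primal z), dual w⟫ + ⟪dual z, A.toEuclideanLin (primal w)⟫) := by
  rw [inner_state, primal_weightP, dual_weightP, inner_add_right, inner_add_right,
    inner_smul_right, inner_smul_right, LinearMap.adjoint_inner_right]
  ring

theorem inner_weightP_self (A : Matrix (Fin k) (Fin n) ℝ) (α : ℝ) (z : State n k) :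
    ⟪z, (weightP A α).toEuclideanLin z⟫ = ‖primal z‖ ^ 2 + ‖dual z‖ ^ 2 +
      2 * α * ⟪A.toEuclideanLin (primal z), dual z⟫ := by
  rw [inner_weightP, real_inner_self_eq_norm_sq, real_inner_self_eq_norm_sq,
    real_inner_comm (A.toEuclideanLin (primal z)) (dual z)]
  ring

theorem weightP_isHermitian (A : Matrix (Fin k) (Fin n) ℝ) (α : ℝ) :
    (weightP A α).IsHermitian := by
  rw [weightP, Matrix.isHermitian_fromBlocks_iff]
  simp [Matrix.conjTranspose_eq_transpose_of_trivial]

theorem weightP_posDef {A : Matrix (Fin k) (Fin n) ℝ} {α : ℝ} (hα : 0 ≤ α)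
    (h : α * sigmaMax A < 1) : (weightP A α).PosDef := by
  refine Matrix.PosDef.of_dotProduct_mulVec_pos (weightP_isHermitian A α) fun x hx => ?_
  have hz : WithLp.toLp 2 x ≠ (0 : State n k) := by simpa using hx
  have h1 : 0 < ⟪WithLp.toLp 2 x, (weightP A α).toEuclideanLin (WithLp.toLp 2 x : State n k)⟫ := by
    rw [inner_weightP_self]
    refine saddle_form_pos hα h (norm_map_le_singularValues_zero _ _) ?_
    by_contra! hc
    exact hz (state_ext hc.1 hc.2)
  rw [EuclideanSpace.inner_eq_star_dotProduct, dotProduct_comm] at h1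
  simpa using h1

/-- The square root of a positive definite matrix as an automorphism of Euclidean space. -/
theorem exists_sqrtMatrix_equiv {P : Matrix (Fin n ⊕ Fin k) (Fin n ⊕ Fin k) ℝ} (hP : P.PosDef) :
    ∃ Q : State n k ≃L[ℝ] State n k, (∀ z, Q z = (sqrtMatrix P).toEuclideanLin z) ∧
      ∀ z w, ⟪Q z, Q w⟫ = ⟪z, P.toEuclideanLin w⟫ := by
  have hP0 : 0 ≤ P := hP.posSemidef.nonneg
  have hS : sqrtMatrix P * sqrtMatrix P = P := CFC.sqrt_mul_sqrt_self P hP0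
  have hH : (sqrtMatrix P).IsHermitian := (Matrix.nonneg_iff_posSemidef.1 (CFC.sqrt_nonneg P)).1
  have hcomp : ∀ w, (sqrtMatrix P).toEuclideanLin ((sqrtMatrix P).toEuclideanLin w) =
      P.toEuclideanLin w := fun w => by
    conv_rhs => rw [← hS]
    simp [Matrix.toLpLin_apply]
  have hin : ∀ z w, ⟪(sqrtMatrix P).toEuclideanLin z, (sqrtMatrix P).toEuclideanLin w⟫ =
      ⟪z, P.toEuclideanLin w⟫ := fun z w => by
    rw [Matrix.isSymmetric_toEuclideanLin_iff.2 hH, hcomp]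
  have hinj : Function.Injective (sqrtMatrix P).toEuclideanLin := by
    rw [injective_iff_map_eq_zero]
    intro z hz
    have hU : IsUnit P := hP.isUnit
    have h1 : P.toEuclideanLin z = 0 := by rw [← hcomp, hz, map_zero]
    have h2 : Function.Injective P.mulVec := Matrix.mulVec_injective_iff_isUnit.2 hU
    have h3 : P.mulVec z.ofLp = 0 := congrArg WithLp.ofLp h1
    exact WithLp.ofLp_injective 2 (h2 (h3.trans (Matrix.mulVec_zero P).symm))
  exact ⟨(LinearEquiv.ofInjectiveEndo _ hinj).toContinuousLinearEquiv, fun _ => rfl, hin⟩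

end StateSpace

/-! ### The primal-dual field: weak contraction and asymptotic stability. -/

section PrimalDualDynamics

variable {n k : ℕ} {f : EuclideanSpace ℝ (Fin n) → ℝ} {A : Matrix (Fin k) (Fin n) ℝ}
  {b : EuclideanSpace ℝ (Fin k)}

open scoped RealInnerProductSpace

theorem primal_pdField (z : State n k) : primal (pdField f A b z) =
    -gradient f (primal z) - A.toEuclideanLin.adjoint (dual z) := by
  rw [← toEuclideanLin_transpose]; rfl

theorem dual_pdField (z : State n k) :
    dual (pdField f A b z) = A.toEuclideanLin (primal z) - b := rfl

theorem primal_pdField_sub (z w : State n k) : primal (pdField f A b z - pdField f A b w) =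
    -(gradient f (primal z) - gradient f (primal w)) -
      A.toEuclideanLin.adjoint (dual (z - w)) := by
  rw [primal_sub, primal_pdField, primal_pdField, dual_sub, map_sub]; abel

theorem dual_pdField_sub (z w : State n k) : dual (pdField f A b z - pdField f A b w) =
    A.toEuclideanLin (primal (z - w)) := by
  rw [dual_sub, dual_pdField, dual_pdField, primal_sub, map_sub]; abel

theorem inner_pdField_sub (z w : State n k) :
    ⟪z - w, pdField f A b z - pdField f A b w⟫ =
      -⟪gradient f (primal z) - gradient f (primal w), primal z - primal w⟫ := by
  rw [inner_state, primal_pdField_sub, dual_pdField_sub, inner_sub_right, inner_neg_right,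
    LinearMap.adjoint_inner_right, real_inner_comm (dual (z - w)),
    real_inner_comm _ (primal (z - w)), primal_sub]
  ring

theorem differentiable_pdField (hf2 : Differentiable ℝ (gradient f)) :
    Differentiable ℝ (pdField f A b) := by
  have h1 : Differentiable ℝ fun z : State n k => gradient f (primal z) :=
    hf2.comp (primalCLM n k).differentiable
  have h2 : Differentiable ℝ fun z : State n k => A.transpose.toEuclideanLin (dual z) :=
    (LinearMap.toContinuousLinearMap A.transpose.toEuclideanLin ∘L dualCLM n k).differentiable
  have h3 : Differentiable ℝ fun z : State n k => A.toEuclideanLin (primal z) :=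
    (LinearMap.toContinuousLinearMap A.toEuclideanLin ∘L primalCLM n k).differentiable
  exact (pairCLM n k).differentiable.comp ((h1.neg.sub h2).prodMk (h3.sub_const b))

theorem primal_fderiv_pdField (hf2 : Differentiable ℝ (gradient f)) (z v : State n k) :
    primal (fderiv ℝ (pdField f A b) z v) =
      -hessian f (primal z) (primal v) - A.toEuclideanLin.adjoint (dual v) := by
  have h1 := (primalCLM n k).hasFDerivAt.comp z
    (differentiable_pdField (A := A) (b := b) hf2 z).hasFDerivAt
  have h2 : HasFDerivAt (fun z : State n k => -gradient f (primal z) -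
      (LinearMap.toContinuousLinearMap A.transpose.toEuclideanLin ∘L dualCLM n k) z)
      (-(hessian f (primal z) ∘L primalCLM n k) -
        LinearMap.toContinuousLinearMap A.transpose.toEuclideanLin ∘L dualCLM n k) z :=
    (((hf2 (primal z)).hasFDerivAt.comp z (primalCLM n k).hasFDerivAt).neg).sub
      (ContinuousLinearMap.hasFDerivAt _)
  rw [← toEuclideanLin_transpose]
  exact congrArg (fun L => L v) (h1.unique h2)

theorem dual_fderiv_pdField (hf2 : Differentiable ℝ (gradient f)) (z v : State n k) :
    dual (fderiv ℝ (pdField f A b) z v) = A.toEuclideanLin (primal v) := by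
  have h1 := (dualCLM n k).hasFDerivAt.comp z
    (differentiable_pdField (A := A) (b := b) hf2 z).hasFDerivAt
  have h2 : HasFDerivAt (fun z : State n k =>
      (LinearMap.toContinuousLinearMap A.toEuclideanLin ∘L primalCLM n k) z - b)
      (LinearMap.toContinuousLinearMap A.toEuclideanLin ∘L primalCLM n k) z :=
    (ContinuousLinearMap.hasFDerivAt _).sub_const b
  exact congrArg (fun L => L v) (h1.unique h2)

theorem isEquilibrium_pdField_iff {z : State n k} : IsEquilibrium (pdField f A b) z ↔
    gradient f (primal z) = -A.toEuclideanLin.adjoint (dual z) ∧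
      A.toEuclideanLin (primal z) = b := by
  rw [IsEquilibrium]
  constructor
  · intro h
    have h1 := congrArg primal h
    have h2 := congrArg dual h
    rw [primal_pdField, primal_zero, sub_eq_zero, neg_eq_iff_eq_neg] at h1
    rw [dual_pdField, dual_zero, sub_eq_zero] at h2
    exact ⟨h1, h2⟩
  · rintro ⟨h1, h2⟩
    refine state_ext ?_ ?_
    · rw [primal_pdField, primal_zero, h1]; abel
    · rw [dual_pdField, dual_zero, h2, sub_self]

theorem inner_pdField_sub_nonpos (hf : ConvexOn ℝ univ f) (hf2 : TwiceDifferentiable f)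
    (z w : State n k) : ⟪z - w, pdField f A b z - pdField f A b w⟫ ≤ 0 := by
  rw [inner_pdField_sub]
  exact neg_nonpos.2 (inner_gradient_sub_nonneg hf hf2.1 _ _)

theorem hasFlow_pdField (hf : ConvexOn ℝ univ f) (hf2 : TwiceDifferentiable f) :
    HasFlow (pdField f A b) :=
  hasFlow_of_monotone (differentiable_pdField hf2.2).continuous (inner_pdField_sub_nonpos hf hf2)

theorem weaklyContractive_pdField (hf : ConvexOn ℝ univ f) (hf2 : TwiceDifferentiable f) :
    WeaklyContractive (fun z => ‖z‖) (pdField f A b) := by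
  refine ⟨hasFlow_pdField hf hf2, fun t₀ _ z w hz hw t ht => ?_⟩
  simpa using norm_sub_le_of_monotone (inner_pdField_sub_nonpos hf hf2) ht
    hz.isSolutionOn_Icc hw.isSolutionOn_Icc

theorem globallyAsymptoticallyStable_pdField (hA : A.rank = k) (hf : ConvexOn ℝ univ f)
    (hf2 : TwiceDifferentiable f) {zs : State n k} (hzs : IsEquilibrium (pdField f A b) zs)
    (hpos : HessianPosDef f (primal zs)) :
    GloballyAsymptoticallyStable (pdField f A b) zs := by
  refine globallyAsymptoticallyStable_of_monotone (differentiable_pdField hf2.2).continuous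
    (inner_pdField_sub_nonpos hf hf2) hzs fun t₀ w hw h => ?_
  have hF0 : pdField f A b zs = 0 := hzs
  have hprimal : ∀ t, t₀ ≤ t → primal (w t) = primal zs := by
    intro t ht
    have h1 := h t ht
    rw [← sub_zero (pdField f A b (w t)), ← hF0, inner_pdField_sub, neg_eq_zero] at h1
    exact eq_of_inner_sub_eq_zero (inner_gradient_sub_nonneg hf hf2.1) (hf2.2 _) hpos h1
  -- A constant primal part has zero velocity, so `Aᵀ` takes equal values at the two dual parts.
  have h2 := deriv_eq_zero_of_const
    ((primalCLM n k).hasFDerivAt.comp_hasDerivWithinAt t₀ (hw t₀ (mem_Ici.2 le_rfl))) le_rfl hprimal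
  rw [primalCLM_apply, primal_pdField, hprimal t₀ le_rfl, (isEquilibrium_pdField_iff.1 hzs).1,
    neg_neg, sub_eq_zero] at h2
  exact state_ext (hprimal t₀ le_rfl) (adjoint_toEuclideanLin_injective hA h2.symm)

/-! ### Strong contraction and optimality under strong convexity. -/

section StronglyConvex

variable {linf lsup ε : ℝ}

theorem linf_le_lsup (hn : 0 < n) (hsc : GradStronglyConvex f linf)
    (hls : LipschitzSmooth f lsup) : linf ≤ lsup := by
  have h1 := hsc (EuclideanSpace.single ⟨0, hn⟩ 1) 0
  have h2 := hls (EuclideanSpace.single ⟨0, hn⟩ 1) 0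
  have h3 := real_inner_le_norm (gradient f (EuclideanSpace.single ⟨0, hn⟩ 1) - gradient f 0)
    (EuclideanSpace.single ⟨0, hn⟩ 1 - 0)
  have h4 : ‖(EuclideanSpace.single ⟨0, hn⟩ 1 : EuclideanSpace ℝ (Fin n)) - 0‖ = 1 := by simp
  rw [h4] at h1 h2 h3
  linarith

theorem sigmaMax_nonneg (A : Matrix (Fin k) (Fin n) ℝ) : 0 ≤ sigmaMax A :=
  A.toEuclideanLin.singularValues_nonneg 0

theorem sigmaMax_pos (hk : 0 < k) (hA : A.rank = k) : 0 < sigmaMax A :=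
  singularValues_pos_of_surjective (toEuclideanLin_surjective hA) (by simpa using hk)

theorem sigmaMin_pos (hk : 0 < k) (hkn : k < n) (hA : A.rank = k) : 0 < sigmaMin A := by
  refine singularValues_pos_of_surjective (toEuclideanLin_surjective hA) ?_
  rw [finrank_euclideanSpace_fin]
  omega

theorem sigmaMin_mul_norm_le (hkn : k < n) (hA : A.rank = k) (v : EuclideanSpace ℝ (Fin k)) :
    sigmaMin A * ‖v‖ ≤ ‖A.toEuclideanLin.adjoint v‖ := by
  have h := singularValues_mul_norm_le_norm_adjoint (toEuclideanLin_surjective hA) v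
  rw [finrank_euclideanSpace_fin] at h
  rwa [sigmaMin, min_eq_left hkn.le]

theorem alphaEps_denom_pos (A : Matrix (Fin k) (Fin n) ℝ) (hl : 0 < lsup) :
    0 < sigmaMax A ^ 2 + 3 / 4 * sigmaMax A * sigmaMin A ^ 2 + lsup ^ 2 := by
  have := sigmaMax_nonneg A
  positivity

theorem alphaEps_pos (A : Matrix (Fin k) (Fin n) ℝ) (hi : 0 < linf) (hl : 0 < lsup) (hε : 0 < ε) :
    0 < alphaEps A linf lsup ε :=
  div_pos (mul_pos hε hi) (alphaEps_denom_pos A hl)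

theorem alphaEps_mul_denom_le (A : Matrix (Fin k) (Fin n) ℝ) (hi : 0 < linf) (hl : 0 < lsup)
    (hε1 : ε < 1) : alphaEps A linf lsup ε *
      (sigmaMax A ^ 2 + 3 / 4 * sigmaMax A * sigmaMin A ^ 2 + lsup ^ 2) ≤ linf := by
  rw [alphaEps, div_mul_cancel₀ _ (alphaEps_denom_pos A hl).ne']
  nlinarith

/-- With `s = sigmaMax A`, `ε * linf * s ≤ lsup * s ≤ (s² + lsup²) / 2`, which is strictly below the
denominator. -/
theorem alphaEps_mul_sigmaMax_lt_one (A : Matrix (Fin k) (Fin n) ℝ) (hi : 0 < linf)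
    (hl : 0 < lsup) (hil : linf ≤ lsup) (hε1 : ε < 1) :
    alphaEps A linf lsup ε * sigmaMax A < 1 := by
  have hs := sigmaMax_nonneg A
  rw [alphaEps, div_mul_eq_mul_div, div_lt_one (alphaEps_denom_pos A hl)]
  have h1 : ε * linf * sigmaMax A ≤ lsup * sigmaMax A :=
    mul_le_mul_of_nonneg_right (by nlinarith) hs
  have h2 : 0 ≤ 3 / 4 * sigmaMax A * sigmaMin A ^ 2 := by positivity
  nlinarith [sq_nonneg (sigmaMax A - lsup), sq_nonneg (sigmaMax A), sq_pos_of_pos hl]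

theorem pdRate_pos (hk : 0 < k) (hkn : k < n) (hA : A.rank = k) (hi : 0 < linf) (hl : 0 < lsup)
    (hε : 0 < ε) : 0 < pdRate A linf lsup ε := by
  have h1 := sigmaMax_pos hk hA
  have h2 := sigmaMin_pos hk hkn hA
  have h3 := alphaEps_pos A hi hl hε
  rw [pdRate]
  positivity

/-- Dissipation of a displacement `v` whose velocity is `(-h - Aᵀ v₂, A v₁)`. -/
theorem inner_weightP_le (hkn : k < n) (hA : A.rank = k) (hi : 0 < linf)
    (hl : 0 < lsup) (hil : linf ≤ lsup) (hε : 0 < ε) (hε1 : ε < 1) {v d : State n k}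
    {h : EuclideanSpace ℝ (Fin n)} (hd₁ : primal d = -h - A.toEuclideanLin.adjoint (dual v))
    (hd₂ : dual d = A.toEuclideanLin (primal v)) (hh : ‖h‖ ≤ lsup * ‖primal v‖)
    (hhv : linf * ‖primal v‖ ^ 2 ≤ ⟪h, primal v⟫) :
    ⟪v, (weightP A (alphaEps A linf lsup ε)).toEuclideanLin d⟫ ≤
      -pdRate A linf lsup ε * ⟪v, (weightP A (alphaEps A linf lsup ε)).toEuclideanLin v⟫ := by
  have key := saddle_dissipation (T := A.toEuclideanLin) (sigmaMax_nonneg A)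
    (A.toEuclideanLin.singularValues_nonneg _ : 0 ≤ sigmaMin A) (alphaEps_pos A hi hl hε).le
    (alphaEps_mul_sigmaMax_lt_one A hi hl hil hε1).le (alphaEps_mul_denom_le A hi hl hε1)
    (norm_map_le_singularValues_zero _ (primal v)) (sigmaMin_mul_norm_le hkn hA (dual v)) hh hhv
  rw [inner_weightP_self, pdRate]
  refine le_trans (le_of_eq ?_) key
  rw [inner_weightP, hd₁, hd₂, map_sub, map_neg, inner_sub_right, inner_neg_right,
    inner_sub_right, inner_neg_right, ← LinearMap.adjoint_inner_left (A.toEuclideanLin) h,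
    ← LinearMap.adjoint_inner_left (A.toEuclideanLin) (A.toEuclideanLin.adjoint (dual v)),
    LinearMap.adjoint_inner_right, real_inner_self_eq_norm_sq, real_inner_self_eq_norm_sq,
    real_inner_comm (dual v), real_inner_comm h (primal v),
    real_inner_comm h (A.toEuclideanLin.adjoint (dual v))]
  ring

/-- `inner_weightP_le` is used twice: with `h` a gradient difference for trajectories, and with `h`
the Hessian applied to a vector for the Jacobian. -/
theorem contractiveWithRate_pdField (hk : 0 < k) (hkn : k < n) (hA : A.rank = k)
    (hf : ConvexOn ℝ univ f) (hf2 : TwiceDifferentiable f) (hi : 0 < linf) (hl : 0 < lsup)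
    (hsc : GradStronglyConvex f linf) (hls : LipschitzSmooth f lsup) (hε : 0 < ε) (hε1 : ε < 1)
    {Q : State n k ≃L[ℝ] State n k}
    (hQ : ∀ z w, ⟪Q z, Q w⟫ = ⟪z, (weightP A (alphaEps A linf lsup ε)).toEuclideanLin w⟫) :
    ContractiveWithRate (fun z => ‖Q z‖) (pdRate A linf lsup ε) (pdField f A b) := by
  have hil := linf_le_lsup (hk.trans hkn) hsc hls
  have hdiff : Differentiable ℝ (pdField f A b) := differentiable_pdField hf2.2
  -- Makes the state space nontrivial, so that the identity has norm `1`.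
  have : Nonempty (Fin n ⊕ Fin k) := ⟨Sum.inl ⟨0, hk.trans hkn⟩⟩
  have hdis : ∀ z w, ⟪(Q : State n k →L[ℝ] State n k) (z - w),
      (Q : State n k →L[ℝ] State n k) (pdField f A b z - pdField f A b w)⟫ ≤
      -pdRate A linf lsup ε * ‖(Q : State n k →L[ℝ] State n k) (z - w)‖ ^ 2 := fun z w => by
    rw [← real_inner_self_eq_norm_sq]
    simp only [ContinuousLinearEquiv.coe_coe, hQ]
    exact inner_weightP_le hkn hA hi hl hil hε hε1 (primal_pdField_sub z w)
      (dual_pdField_sub z w) (by rw [primal_sub]; exact hls _ _)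
      (by rw [primal_sub]; exact hsc _ _)
  refine ⟨pdRate_pos hk hkn hA hi hl hε, ⟨hasFlow_pdField hf hf2, fun t₀ _ z w hz hw t ht => ?_⟩,
    hdiff, fun z => exists_hasMatrixMeasure_le Q fun v => ?_⟩
  · exact norm_sub_le_of_dissipative hdis ht hz.isSolutionOn_Icc hw.isSolutionOn_Icc
  · rw [← real_inner_self_eq_norm_sq, hQ, hQ]
    refine inner_weightP_le hkn hA hi hl hil hε hε1 (primal_fderiv_pdField hf2.2 z v)
      (dual_fderiv_pdField hf2.2 z v) ?_ (mul_norm_sq_le_inner_fderiv hsc (hf2.2 _) _)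
    have hlip : LipschitzWith lsup.toNNReal (gradient f) := LipschitzWith.of_dist_le_mul
      fun x y => by
        rw [dist_eq_norm, dist_eq_norm, Real.coe_toNNReal _ hl.le]; exact hls x y
    refine ((hessian f (primal z)).le_opNorm _).trans
      (mul_le_mul_of_nonneg_right ?_ (norm_nonneg _))
    simpa [hessian, Real.coe_toNNReal _ hl.le] using norm_fderiv_le_of_lipschitz ℝ (x₀ := primal z) hlip

/-- Equilibria are Karush-Kuhn-Tucker points, hence optimal. -/
theorem isSolutionOfProgram_of_isEquilibrium (hf : ConvexOn ℝ univ f) (hd : Differentiable ℝ f)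
    {zs : State n k} (hzs : IsEquilibrium (pdField f A b) zs) :
    IsSolutionOfProgram f A b (primal zs) := by
  obtain ⟨h1, h2⟩ := isEquilibrium_pdField_iff.1 hzs
  refine ⟨h2, fun y hy => ?_⟩
  have h := add_inner_gradient_le hf hd (primal zs) y
  rwa [h1, inner_neg_left, LinearMap.adjoint_inner_left, map_sub, hy, h2, sub_self,
    inner_zero_right, neg_zero, add_zero] at h

/-- Midpoint argument: with `d = (y - x) / 2`, feasibility gives `⟪∇f x, d⟫ = 0`, so `f (x + d) +
linf‖d‖² ≤ f y ≤ f x ≤ f (x + d)` and `d = 0`. -/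
theorem IsSolutionOfProgram.unique (hf : ConvexOn ℝ univ f) (hd : Differentiable ℝ f)
    (hi : 0 < linf) (hsc : GradStronglyConvex f linf) {zs : State n k}
    (hzs : IsEquilibrium (pdField f A b) zs) {y : EuclideanSpace ℝ (Fin n)}
    (hy : IsSolutionOfProgram f A b y) : y = primal zs := by
  obtain ⟨h1, h2⟩ := isEquilibrium_pdField_iff.1 hzs
  have hopt := isSolutionOfProgram_of_isEquilibrium hf hd hzs
  set x := primal zs
  obtain ⟨d, hd'⟩ : ∃ d, d = (1 / 2 : ℝ) • (y - x) := ⟨_, rfl⟩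
  have hyx : y = x + d + d := by
    rw [hd', add_assoc, ← add_smul]; norm_num
  have hAd : A.toEuclideanLin d = 0 := by
    rw [hd', map_smul, map_sub, hy.1, h2, sub_self, smul_zero]
  have hq := hopt.2 (x + d) (by rw [map_add, hAd, h2, add_zero])
  have h3 := add_inner_gradient_le hf hd (x + d) y
  have h4 := hsc (x + d) x
  have h5 := hy.2 x h2
  have h6 : ⟪gradient f x, d⟫ = 0 := by
    rw [h1, inner_neg_left, LinearMap.adjoint_inner_left, hAd, inner_zero_right, neg_zero]
  rw [show y - (x + d) = d by rw [hyx]; abel] at h3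
  rw [add_sub_cancel_left, inner_sub_left, h6] at h4
  have h7 : ‖d‖ ^ 2 ≤ 0 := by
    by_contra hc
    nlinarith
  have h8 : d = 0 := by simpa using le_antisymm h7 (sq_nonneg _)
  rw [hyx, h8, add_zero, add_zero]

end StronglyConvex

end PrimalDualDynamics

end

end PrimalDual

/-! ### Assembly of the theorem. -/

theorem theorem2 (n k : ℕ) (hk : 0 < k) (hkn : k < n)
    (f : EuclideanSpace ℝ (Fin n) → ℝ) (A : Matrix (Fin k) (Fin n) ℝ)
    (b : EuclideanSpace ℝ (Fin k))
    (hA : A.rank = k) (hf : ConvexOn ℝ Set.univ f) (hf2 : PrimalDual.TwiceDifferentiable f) :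
    PrimalDual.WeaklyContractive (fun z => ‖z‖) (PrimalDual.pdField f A b) ∧
    (∀ zs : PrimalDual.State n k, PrimalDual.IsEquilibrium (PrimalDual.pdField f A b) zs →
      PrimalDual.HessianPosDef f (PrimalDual.primal zs) →
        PrimalDual.GloballyAsymptoticallyStable (PrimalDual.pdField f A b) zs) ∧
    (∀ linf lsup : ℝ, 0 < linf → 0 < lsup →
      PrimalDual.GradStronglyConvex f linf → PrimalDual.LipschitzSmooth f lsup →
        (∀ ε : ℝ, 0 < ε → ε < 1 →
          0 < PrimalDual.alphaEps A linf lsup ε ∧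
          (PrimalDual.weightP A (PrimalDual.alphaEps A linf lsup ε)).PosDef ∧
          PrimalDual.ContractiveWithRate
            (PrimalDual.weightedNorm (PrimalDual.sqrtMatrix
              (PrimalDual.weightP A (PrimalDual.alphaEps A linf lsup ε))))
            (PrimalDual.pdRate A linf lsup ε)
            (PrimalDual.pdField f A b)) ∧
        (∃ zs : PrimalDual.State n k,
          PrimalDual.IsEquilibrium (PrimalDual.pdField f A b) zs ∧
          (∀ w : PrimalDual.State n k,
            PrimalDual.IsEquilibrium (PrimalDual.pdField f A b) w → w = zs) ∧
          PrimalDual.GloballyExponentiallyStable (PrimalDual.pdField f A b) zs ∧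
          PrimalDual.IsSolutionOfProgram f A b (PrimalDual.primal zs) ∧
          (∀ y : EuclideanSpace ℝ (Fin n),
            PrimalDual.IsSolutionOfProgram f A b y → y = PrimalDual.primal zs))) := by
  refine ⟨PrimalDual.weaklyContractive_pdField hf hf2, fun zs hzs hpos =>
    PrimalDual.globallyAsymptoticallyStable_pdField hA hf hf2 hzs hpos,
    fun linf lsup hi hl hsc hls => ?_⟩
  have hil := PrimalDual.linf_le_lsup (hk.trans hkn) hsc hls
  have hP : ∀ ε : ℝ, 0 < ε → ε < 1 →
      (PrimalDual.weightP A (PrimalDual.alphaEps A linf lsup ε)).PosDef := fun ε hε hε1 =>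
    PrimalDual.weightP_posDef (PrimalDual.alphaEps_pos A hi hl hε).le
      (PrimalDual.alphaEps_mul_sigmaMax_lt_one A hi hl hil hε1)
  refine ⟨fun ε hε hε1 => ⟨PrimalDual.alphaEps_pos A hi hl hε, hP ε hε hε1, ?_⟩, ?_⟩
  · obtain ⟨Q, hQ, hQP⟩ := PrimalDual.exists_sqrtMatrix_equiv (hP ε hε hε1)
    have h := PrimalDual.contractiveWithRate_pdField (b := b) hk hkn hA hf hf2 hi hl hsc hls
      hε hε1 hQP
    have hN : PrimalDual.weightedNorm (PrimalDual.sqrtMatrix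
        (PrimalDual.weightP A (PrimalDual.alphaEps A linf lsup ε))) = fun z => ‖Q z‖ :=
      funext fun z => by rw [hQ]; rfl
    rwa [hN]
  -- The claims about the equilibrium do not involve `ε`; any value in `(0, 1)` serves.
  · obtain ⟨Q, -, hQP⟩ := PrimalDual.exists_sqrtMatrix_equiv (hP (1 / 2) (by norm_num)
      (by norm_num))
    have h := PrimalDual.contractiveWithRate_pdField (b := b) hk hkn hA hf hf2 hi hl hsc hls
      (by norm_num) (by norm_num) hQP
    obtain ⟨zs, hzs, huniq, hges⟩ := h.2.1.exists_equilibrium h.1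
    exact ⟨zs, hzs, huniq, hges, PrimalDual.isSolutionOfProgram_of_isEquilibrium hf hf2.1 hzs,
      fun y hy => hy.unique hf hf2.1 hi hsc hzs⟩
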